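/- Consider the finite continuum-armed bandit: there are $N\ge 2$ arms with covariates $a_1,\dots,a_N$ i.i.d. uniform on $[0,1]$; conditionally on $(a_1,\dots,a_N)$ the rewards $y_1,\dots,y_N\in[0,1]$ are independent and $y_i$ has mean $m(a_i)$, where $m:[0,1]\to[0,1]$ is measurable and unknown. At each of $T$ rounds one pulls an arm $\phi(t)$ not pulled before and observes $y_{\phi(t)}$. If $\phi^*$ is a permutation of $\{1,\dots,N\}$ with $m(a_{\phi^*(1)})\ge\dots\ge m(a_{\phi^*(N)})$, the regret is $$R_T=\sum_{t=1}^{T}m(a_{\phi^*(t)})-\sum_{t=1}^{T}m(a_{\phi(t)}).$$ Let $p=T/N$, let $\lambda$ be Lebesgue measure on $[0,1]$, and let $M=\inf\{A:\lambda(\{x:m(x)\ge A\})<p\}$. Assume that for constants $L,Q>0$ $$|m(x)-m(y)|\le\max\{|M-m(x)|,\,L|x-y|\}\quad\text{for all }x,y\in[0,1],$$ $$\lambda(\{x:|M-m(x)|\le\epsilon\})\le Q\epsilon\quad\text{for all }\epsilon\in(0,1).$$ The algorithm UCBF with parameters $K\in\mathbb N$, $\delta>0$ splits $[0,1]$ into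 the $K$ intervals $I_k=[\frac{k-1}{K},\frac kK)$ for $k<K$ and $I_K=[\frac{K-1}{K},1]$. An interval is alive if it initially contains at least two arms and at least one of its arms has not been pulled. UCBF first pulls one arm in each alive interval. Then, at each round $t$ up to round $T$, it selects an alive interval $I_k$ maximizing $\widehat m_k+\sqrt{\log(T/\delta)/(2n_k)}$, where $n_k$ is the number of arms pulled so far in $I_k$ and $\widehat m_k$ is the average of the rewards they gave (ties are broken arbitrarily). Each time an interval is selected, the arm pulled is drawn uniformly at random among its remaining arms. Statement. For all $L,Q>0$ there is a constant $C_{Q,L}$, depending only on $Q$ and $L$, such that the following holds for all $N\ge 2$, all $m$ as above and all integers $T$ of the form $T=0.5N^{\alpha}$ with $$\alpha\in(2/3+\epsilon_N,1],\qquad \epsilon_N=\frac{\frac23\log\log N+\log 2}{\log N}.$$ UCBF with $\delta=N^{-4/3}$ and $K=\lfloor\alpha^{2/3}(2T)^{1/(3\alpha)}\log(2T)^{-2/3}\rfloor$ satisfies $$R_T\le C_{Q,L}\,T^{1/(3\alpha)}\log(T)^{4/3}$$ with probability at least $1-12\,(N^{-1}\lor e^{-N^{1/3}/3})$. -/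

import Mathlib

open MeasureTheory ProbabilityTheory
open scoped unitInterval

noncomputable section

namespace FCAB

/-! ### Mean reward function -/

/-- The threshold `M`: the infimum of the levels `A` with `λ {x : m x ≥ A} < p`, where `λ` is the
Lebesgue measure on `[0,1]`. -/
def threshold (m : I → ℝ) (p : ℝ) : ℝ :=
  sInf {A : ℝ | (volume : Measure I).real {x | A ≤ m x} < p}

/-- Weak Lipschitz condition around the level `M`, with constant `L`. -/
def WeakLipschitz (m : I → ℝ) (M L : ℝ) : Prop :=
  ∀ x y : I, |m x - m y| ≤ max |M - m x| (L * |(x : ℝ) - (y : ℝ)|)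

/-- Margin condition at the level `M`, with constant `Q`. -/
def Margin (m : I → ℝ) (M Q : ℝ) : Prop :=
  ∀ ε : ℝ, 0 < ε → ε < 1 → (volume : Measure I).real {x | |M - m x| ≤ ε} ≤ Q * ε

/-! ### The finite continuum-armed bandit -/

/-- The environment: the covariates `a i` are i.i.d. uniform on `[0,1]` and, conditionally on all
the covariates, the rewards `y i` are independent, with values in `[0,1]` and means `m (a i)`.
The conditional law of the vector of rewards, given that the vector of covariates is `x`, is the
product measure of the `ν i`, which may depend on `i` and on `x`. -/
structure IsEnvironment {Ω : Type*} [MeasurableSpace Ω] (μ : Measure Ω) {N : ℕ} (m : I → ℝ)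
    (a : Fin N → Ω → I) (y : Fin N → Ω → ℝ) : Prop where
  measurable_covariate : ∀ i, Measurable (a i)
  measurable_reward : ∀ i, Measurable (y i)
  indep : iIndepFun a μ
  uniform : ∀ i, μ.map (a i) = volume
  rewards : ∃ κ : Kernel (Fin N → I) (Fin N → ℝ),
    IsMarkovKernel κ ∧
    HasCondDistrib (fun ω i => y i ω) (fun ω i => a i ω) κ μ ∧
    ∀ x : Fin N → I, ∃ ν : Fin N → Measure ℝ,
      (∀ i, IsProbabilityMeasure (ν i) ∧ (∀ᵐ r ∂(ν i), r ∈ Set.Icc (0 : ℝ) 1) ∧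
        ∫ r, r ∂(ν i) = m (x i)) ∧
      κ x = Measure.pi ν

/-- The oracle order `φ*`: a permutation of the arms that sorts them by decreasing mean reward. -/
def oracle {N : ℕ} (m : I → ℝ) (x : Fin N → I) : Equiv.Perm (Fin N) :=
  Tuple.sort fun i => -m (x i)

theorem oracle_antitone {N : ℕ} (m : I → ℝ) (x : Fin N → I) :
    Antitone fun t => m (x (oracle m x t)) := fun s t h => by
  have := Tuple.monotone_sort (fun i => -m (x i)) h
  simpa [oracle] using this

/-- The regret after `T` pulls. Rounds are numbered from `0`: `φ t` is the arm pulled when exactly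
`t` arms have been pulled before. -/
def regret {N : ℕ} (m : I → ℝ) (T : ℕ) (x : Fin N → I) (φ : ℕ → Fin N) : ℝ :=
  ∑ t : Fin N with t.val < T, m (x (oracle m x t)) - ∑ t ∈ Finset.range T, m (x (φ t))

/-! ### The algorithm UCBF -/

/-- The `K` cells `[k/K, (k+1)/K)` for `k = 0, …, K - 1`, the last one being closed. -/
def cell (K : ℕ) (k : Fin K) : Set I :=
  {x | (k : ℝ) / K ≤ x ∧ ((x : ℝ) < ((k : ℝ) + 1) / K ∨ (k : ℕ) + 1 = K)}

section Path

variable {N K : ℕ} (x : Fin N → I) (r : Fin N → ℝ) (φ : ℕ → Fin N)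

open Classical in
/-- The arms of cell `k`; the number `N_k` is its cardinality. -/
def armsIn (k : Fin K) : Finset (Fin N) := {i | x i ∈ cell K k}

open Classical in
/-- The rounds, among the first `t` ones, at which an arm of cell `k` was pulled;
the number `n_k(t)` is its cardinality. -/
def pulls (t : ℕ) (k : Fin K) : Finset ℕ := {s ∈ Finset.range t | x (φ s) ∈ cell K k}

open Classical in
/-- The arms of cell `k` that are still available after `t` pulls. -/
def remaining (t : ℕ) (k : Fin K) : Finset (Fin N) := {i ∈ armsIn x k | ∀ s < t, φ s ≠ i}

/-- Cell `k` is alive after `t` pulls: it had at least two arms at the start, and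
it is not exhausted. -/
def Alive (t : ℕ) (k : Fin K) : Prop := 2 ≤ (armsIn x k).card ∧ (remaining x φ t k).Nonempty

/-- The average of the rewards obtained from cell `k` in the first `t` pulls. -/
def empMean (t : ℕ) (k : Fin K) : ℝ := (∑ s ∈ pulls x φ t k, r (φ s)) / (pulls x φ t k).card

/-- The upper confidence bound of cell `k` after `t` pulls (used once `k` has been sampled). -/
def ucb (T : ℕ) (δ : ℝ) (t : ℕ) (k : Fin K) : ℝ :=
  empMean x r φ t k + √(Real.log (T / δ) / (2 * (pulls x φ t k).card))

/-- UCBF may select cell `k` when `t` arms have been pulled. The cell has to be alive. As long as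
some alive cell has not been sampled (initialisation: one pull in each alive cell), the selected
cell is such a cell; afterwards it maximizes the upper confidence bound among the alive cells. -/
def MaySelect (T : ℕ) (δ : ℝ) (t : ℕ) (k : Fin K) : Prop :=
  Alive x φ t k ∧
  ((∃ l : Fin K, Alive x φ t l ∧ pulls x φ t l = ∅) → pulls x φ t k = ∅) ∧
  ((∀ l : Fin K, Alive x φ t l → pulls x φ t l ≠ ∅) →
    ∀ l : Fin K, Alive x φ t l → ucb x r φ T δ t l ≤ ucb x r φ T δ t k)

end Path

open Classical in
/-- `φ` is the sequence of arms pulled by a run of UCBF with budget `T` and parameters `K`, `δ`.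
For each round `t < T`, the σ-algebra `ℱ t` contains the information available just before the arm
of that round is drawn, including the selected cell `k t`; it also contains the whole environment,
so that the last condition says that the arm is drawn uniformly at random among the arms remaining
in the selected cell, by a randomization independent of the environment and of the past.
The order of the initial pulls and the way in which ties are broken are arbitrary. -/
def IsUCBF {Ω : Type*} [mΩ : MeasurableSpace Ω] (μ : Measure Ω) {N : ℕ}
    (a : Fin N → Ω → I) (y : Fin N → Ω → ℝ) (T K : ℕ) (δ : ℝ) (φ : ℕ → Ω → Fin N) : Prop :=
  ∃ (ℱ : Filtration ℕ mΩ) (k : ℕ → Ω → Fin K),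
    (∀ i, Measurable[ℱ 0] (a i)) ∧
    (∀ i, Measurable[ℱ 0] (y i)) ∧
    ∀ t < T,
      Measurable[ℱ t] (k t) ∧
      Measurable[ℱ (t + 1)] (φ t) ∧
      (∀ᵐ ω ∂μ, MaySelect (fun i => a i ω) (fun i => y i ω) (fun s => φ s ω) T δ t (k t ω)) ∧
      ∀ i : Fin N,
        μ[Set.indicator {ω | φ t ω = i} (fun _ => (1 : ℝ)) | ℱ t] =ᵐ[μ] fun ω =>
          if i ∈ remaining (fun j => a j ω) (fun s => φ s ω) t (k t ω) then
            ((remaining (fun j => a j ω) (fun s => φ s ω) t (k t ω)).card : ℝ)⁻¹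
          else 0

/-- `ε_N = (2/3 · log log N + log 2) / log N`. -/
def epsilon (N : ℕ) : ℝ :=
  (2 / 3 * Real.log (Real.log N) + Real.log 2) / Real.log N

/-- The number of cells `⌊α^(2/3) (2T)^(1/(3α)) log(2T)^(-2/3)⌋`. -/
def numCells (α : ℝ) (T : ℕ) : ℕ :=
  ⌊α ^ (2 / 3 : ℝ) * (2 * T : ℝ) ^ (1 / (3 * α)) * Real.log (2 * T) ^ (-(2 / 3) : ℝ)⌋₊

end FCAB

end

noncomputable section

namespace FCAB

/-! ### Exponential moments of the rewards of a set of arms -/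

/-! Everything is measured by the distance of a cell mean to the threshold M. By the weak Lipschitz
condition, m oscillates in a cell by at most the larger of L/K and the distance to M, so a cell
whose mean is within u ≥ L/K of M has all its values within 2u of M
(`abs_sub_le_of_abs_cellMean_sub_le`), and the margin condition leaves O(Ku) such cells
(`card_cells_near_le`).

The probabilistic core is the concentration of the average reward of a cell, although arms are
chosen adaptively and without replacement. Given which arms lie in the cell, their covariates are
i.i.d. uniform there, so any fixed set of these arms has Hoeffding's exponential moments around the
cell mean (`integral_fits_mul_prod_exp_le`). The process `samplingProcess` has constant expectation
along the run and carries this bound over to the arms actually drawn (`integral_samplingProcess`,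
`measure_sum_pulls_ge_le`). Together with the concentration of the arm counts this makes `IsGoodRun`
likely.

On a good run, a cell that is worse by D than some alive cell at every round receives at most 1 + 2
log(T/δ)/D² pulls (`card_pulls_le`). Below M, this applies because the cells of mean at least M -
4L/K contain at least T arms, so one of them is always alive (`exists_alive`). Above M, the finite
supply of arms is decisive: if a cell at height Δ above M were never exhausted, cells below M + Δ/2
would be pulled rarely, while those above hold about NΔ/(8L) fewer arms than the budget. The T pulls
could not be placed once Δ exceeds a constant over K (`exhausted`).

Hence high cells lose nothing, the O(1) cells within O(1/K) of M lose O(N/K²), and the low cells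
lose O(K log(T/δ) log K) by dyadic summation. The choice of K, of order N^(1/3) (log N)^(-2/3),
makes both of order N^(1/3) (log N)^(4/3). -/

theorem one_sub_add_mul_exp_le {q : ℝ} (h0 : 0 ≤ q) (h1 : q ≤ 1) (s : ℝ) :
    1 - q + q * Real.exp s ≤ Real.exp (s * q + s ^ 2 / 8) := by
  -- The Bernoulli law of parameter q: the claim is Hoeffding's lemma for it, with the centring
  -- moved to the right-hand side.
  let μ : Measure ℝ := ENNReal.ofReal (1 - q) • Measure.dirac 0 + ENNReal.ofReal q • Measure.dirac 1
  have hμ : IsProbabilityMeasure μ := ⟨by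
    simp only [μ, Measure.coe_add, Measure.coe_smul, Pi.add_apply, Pi.smul_apply, measure_univ,
      smul_eq_mul, mul_one]
    rw [← ENNReal.ofReal_add (by linarith) h0]
    simp⟩
  have hint : ∀ f : ℝ → ℝ, ∫ x, f x ∂μ = (1 - q) * f 0 + q * f 1 := fun f => by
    simp only [μ]
    rw [integral_add_measure, integral_smul_measure, integral_smul_measure, integral_dirac,
      integral_dirac, ENNReal.toReal_ofReal (by linarith), ENNReal.toReal_ofReal h0]
    · simp
    · exact (integrable_dirac (by simp)).smul_measure (by simp)
    · exact (integrable_dirac (by simp)).smul_measure (by simp)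
  have hb : ∀ᵐ x ∂μ, id x ∈ Set.Icc (0 : ℝ) 1 := by
    simp only [μ]
    rw [ae_add_measure_iff]
    constructor
    · exact Measure.ae_smul_measure ((ae_dirac_iff measurableSet_Icc).2 (by simp)) _
    · exact Measure.ae_smul_measure ((ae_dirac_iff measurableSet_Icc).2 (by simp)) _
  have := (hasSubgaussianMGF_of_mem_Icc (X := id) (μ := μ) aemeasurable_id hb).mgf_le s
  rw [mgf, hint, hint] at this
  simp only [id, mul_zero, mul_one, zero_add, zero_sub] at this
  have e : ((((‖(1 : ℝ) - 0‖₊ / 2) ^ 2 : NNReal) : ℝ) * s ^ 2 / 2) = s ^ 2 / 8 := by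
    simp; ring
  rw [e, mul_sub, mul_one, Real.exp_sub, mul_neg, Real.exp_neg] at this
  rw [Real.exp_add]
  calc 1 - q + q * Real.exp s
      = Real.exp (s * q) * ((1 - q) * (Real.exp (s * q))⁻¹
        + q * (Real.exp s / Real.exp (s * q))) := by field_simp
    _ ≤ _ := by gcongr

/-- Truncation of a reward to `[0,1]`. -/
def clip (r : ℝ) : ℝ := max 0 (min 1 r)

theorem clip_nonneg (r : ℝ) : 0 ≤ clip r := le_max_left _ _

theorem clip_le_one (r : ℝ) : clip r ≤ 1 := max_le zero_le_one (min_le_left _ _)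

theorem clip_of_mem {r : ℝ} (h : r ∈ Set.Icc (0 : ℝ) 1) : clip r = r := by
  rw [clip, min_eq_right h.2, max_eq_right h.1]

theorem measurable_clip : Measurable clip := by unfold clip; fun_prop

theorem exp_mul_le_of_mem {s u : ℝ} (h0 : 0 ≤ u) (h1 : u ≤ 1) :
    Real.exp (s * u) ≤ 1 - u + u * Real.exp s := by
  have := convexOn_exp.2 (Set.mem_univ (0 : ℝ)) (Set.mem_univ s) (by linarith : 0 ≤ 1 - u) h0
    (by ring)
  simp only [smul_eq_mul, mul_zero, zero_add, Real.exp_zero, mul_one] at this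
  rwa [mul_comm s u]

/-- Clipping bounds the weights everywhere, whereas the rewards lie in [0,1] only almost surely. -/
theorem integrable_exp_clip (ν : Measure ℝ) [IsFiniteMeasure ν] (s q : ℝ) :
    Integrable (fun r => Real.exp (s * (clip r - q))) ν := by
  refine Integrable.of_bound (C := Real.exp (|s| * (1 + |q|))) ?_ ?_
  · exact (by have := measurable_clip; fun_prop : Measurable _).aestronglyMeasurable
  · refine .of_forall fun r => ?_
    rw [Real.norm_eq_abs, Real.abs_exp, Real.exp_le_exp]
    refine (le_abs_self _).trans ?_
    rw [abs_mul]
    gcongr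
    refine (abs_sub _ _).trans ?_
    gcongr
    rw [abs_of_nonneg (clip_nonneg r)]
    exact clip_le_one r

theorem integral_one_sub_add_mul {X : Type*} [MeasurableSpace X] {ν : Measure X} [IsFiniteMeasure ν]
    {f : X → ℝ} (hf : Integrable f ν) (c : ℝ) :
    ∫ x, (1 - f x + f x * c) ∂ν = ν.real Set.univ - ∫ x, f x ∂ν + (∫ x, f x ∂ν) * c := by
  have h1 : Integrable (fun x => 1 - f x) ν := (integrable_const 1).sub hf
  rw [integral_add h1 (hf.mul_const c), integral_sub (integrable_const 1) hf, integral_mul_const]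
  simp

/-- The exponential lies below its chord on [0,1]. The resulting bound is affine in the mean of ν,
so it can later be averaged over the covariate. -/
theorem integral_exp_clip_le (ν : Measure ℝ) [IsProbabilityMeasure ν]
    (h : ∀ᵐ r ∂ν, r ∈ Set.Icc (0 : ℝ) 1) (s q : ℝ) :
    ∫ r, Real.exp (s * (clip r - q)) ∂ν ≤
      Real.exp (-(s * q)) * (1 - (∫ r, r ∂ν) + (∫ r, r ∂ν) * Real.exp s) := by
  have hi : Integrable (fun r : ℝ => r) ν := Integrable.of_mem_Icc 0 1 aemeasurable_id h
  calc ∫ r, Real.exp (s * (clip r - q)) ∂ν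
      ≤ ∫ r, Real.exp (-(s * q)) * (1 - r + r * Real.exp s) ∂ν := by
        refine integral_mono_ae (integrable_exp_clip ν s q)
          ((((integrable_const 1).sub hi).add (hi.mul_const _)).const_mul _) ?_
        filter_upwards [h] with r hr
        rw [clip_of_mem hr, mul_sub, sub_eq_neg_add, Real.exp_add]
        gcongr
        exact exp_mul_le_of_mem hr.1 hr.2
    _ = _ := by
        rw [integral_const_mul, integral_one_sub_add_mul hi]
        simp

open Classical in
/-- Indicator that the arm `i` with covariate `u` lies in `J` iff it belongs to `A`. -/
def fits {N : ℕ} (J : Set I) (A : Finset (Fin N)) (i : Fin N) (u : I) : ℝ :=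
  if u ∈ J ↔ i ∈ A then 1 else 0

section Moments

variable {Ω : Type*} [MeasurableSpace Ω] {μ : Measure Ω} [IsProbabilityMeasure μ] {N : ℕ}
  {m : I → ℝ} {a : Fin N → Ω → I} {y : Fin N → Ω → ℝ}

theorem measurable_fits {J : Set I} (hJ : MeasurableSet J) (A : Finset (Fin N)) (i : Fin N) :
    Measurable (fits J A i) := by
  unfold fits
  refine Measurable.ite ?_ measurable_const measurable_const
  by_cases h : i ∈ A
  · simpa [h] using hJ
  · simp only [h, iff_false]
    exact hJ.compl

theorem fits_nonneg (J : Set I) (A : Finset (Fin N)) (i : Fin N) (u : I) : 0 ≤ fits J A i u := by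
  unfold fits; split_ifs <;> norm_num

theorem fits_le_one (J : Set I) (A : Finset (Fin N)) (i : Fin N) (u : I) : fits J A i u ≤ 1 := by
  unfold fits; split_ifs <;> norm_num

/-- The product of the `fits` is the indicator that A is exactly the set of arms in J. Integrating
out the rewards leaves a product over independent covariates, and each factor from S is an average
over J of a chord bound. -/
theorem integral_fits_mul_prod_exp_le (hE : IsEnvironment μ m a y) (hm : Measurable m)
    (hm01 : ∀ x, m x ∈ Set.Icc (0 : ℝ) 1) {J : Set I} (hJ : MeasurableSet J) {q : ℝ}
    (hq0 : 0 ≤ q) (hq1 : q ≤ 1) (hq : ∫ u in J, m u = (volume : Measure I).real J * q) (s : ℝ)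
    {A S : Finset (Fin N)} (hS : S ⊆ A) :
    ∫ ω, (∏ i, fits J A i (a i ω)) * ∏ i ∈ S, Real.exp (s * (clip (y i ω) - q)) ∂μ ≤
      (∫ ω, ∏ i, fits J A i (a i ω) ∂μ) * Real.exp (s ^ 2 / 8) ^ S.card := by
  classical
  obtain ⟨κ, hκ, hd, hν⟩ := hE.rewards
  have hfm := fun i => measurable_fits hJ A i
  have hcl := measurable_clip
  have hpi : μ.map (fun ω i => a i ω) = Measure.pi fun _ : Fin N => (volume : Measure I) := by
    rw [hE.indep.map_fun_eq_pi_map fun i => (hE.measurable_covariate i).aemeasurable]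
    simp_rw [hE.uniform]
  let F : (Fin N → I) × (Fin N → ℝ) → ℝ := fun p =>
    (∏ i, fits J A i (p.1 i)) * ∏ i, if i ∈ S then Real.exp (s * (clip (p.2 i) - q)) else 1
  have hFm : Measurable F := by
    refine Measurable.mul ?_ ?_
    · exact Finset.measurable_prod _ fun i _ =>
        (hfm i).comp ((measurable_pi_apply i).comp measurable_fst)
    · refine Finset.measurable_prod _ fun i _ => ?_
      split_ifs <;> fun_prop
  let B : ℝ := ∏ i : Fin N, if i ∈ S then Real.exp (|s| * (1 + |q|)) else 1
  have hpb : ∀ r : Fin N → ℝ,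
      0 ≤ (∏ i, if i ∈ S then Real.exp (s * (clip (r i) - q)) else 1) ∧
      (∏ i, if i ∈ S then Real.exp (s * (clip (r i) - q)) else 1) ≤ B := by
    intro r
    have h0 : ∀ i, 0 ≤ if i ∈ S then Real.exp (s * (clip (r i) - q)) else 1 := by
      intro i; split_ifs <;> positivity
    refine ⟨Finset.prod_nonneg fun i _ => h0 i, Finset.prod_le_prod (fun i _ => h0 i) fun i _ => ?_⟩
    split_ifs
    · rw [Real.exp_le_exp]
      refine (le_abs_self _).trans ?_
      rw [abs_mul]
      gcongr
      refine (abs_sub _ _).trans ?_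
      gcongr
      rw [abs_of_nonneg (clip_nonneg _)]
      exact clip_le_one _
    · exact le_rfl
  have hfb : ∀ x : Fin N → I, 0 ≤ ∏ i, fits J A i (x i) ∧ ∏ i, fits J A i (x i) ≤ 1 := fun x =>
    ⟨Finset.prod_nonneg fun i _ => fits_nonneg ..,
      Finset.prod_le_one (fun i _ => fits_nonneg ..) fun i _ => fits_le_one ..⟩
  have hFi : ∀ (ρ : Measure ((Fin N → I) × (Fin N → ℝ))) [IsFiniteMeasure ρ], Integrable F ρ := by
    intro ρ _
    refine Integrable.of_bound (C := B) hFm.aestronglyMeasurable (.of_forall fun p => ?_)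
    obtain ⟨h1, h2⟩ := hfb p.1
    obtain ⟨h3, h4⟩ := hpb p.2
    rw [Real.norm_eq_abs, abs_of_nonneg (mul_nonneg h1 h3)]
    nlinarith
  have hmeasa : Measurable fun ω i => a i ω :=
    measurable_pi_lambda _ hE.measurable_covariate
  have hprob : IsProbabilityMeasure (μ.map fun ω i => a i ω) :=
    Measure.isProbabilityMeasure_map hmeasa.aemeasurable
  let h : I → ℝ := fun u => Real.exp (-(s * q)) * (1 - m u + m u * Real.exp s)
  have hhm : Measurable h := by fun_prop
  have hh0 : ∀ u, 0 ≤ h u := fun u => by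
    have := hm01 u
    have h1 := this.1
    have h2 : 0 ≤ 1 - m u := by linarith [this.2]
    positivity
  have hhb : ∀ u, h u ≤ Real.exp (-(s * q)) * (1 + Real.exp s) := fun u => by
    have := hm01 u
    simp only [h]
    gcongr
    · linarith [this.1]
    · exact mul_le_of_le_one_left (Real.exp_pos s).le this.2
  have hhi : Integrable h (volume : Measure I) :=
    Integrable.of_bound hhm.aestronglyMeasurable _ (.of_forall fun u => by
      rw [Real.norm_eq_abs, abs_of_nonneg (hh0 u)]; exact hhb u)
  calc ∫ ω, (∏ i, fits J A i (a i ω)) * ∏ i ∈ S, Real.exp (s * (clip (y i ω) - q)) ∂μ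
      = ∫ ω, F (fun i => a i ω, fun i => y i ω) ∂μ := by
        simp only [F, Finset.prod_ite_mem, Finset.univ_inter]
    _ = ∫ p, F p ∂((μ.map fun ω i => a i ω) ⊗ₘ κ) := by
        rw [← hd.map_eq, integral_map hd.aemeasurable hFm.aestronglyMeasurable]
    _ = ∫ x, ∫ r, F (x, r) ∂κ x ∂(μ.map fun ω i => a i ω) :=
        Measure.integral_compProd (hFi _)
    _ ≤ ∫ x, ∏ i, (fits J A i (x i) * if i ∈ S then h (x i) else 1) ∂(μ.map fun ω i => a i ω) := by
        refine integral_mono (hFi ((μ.map fun ω i => a i ω) ⊗ₘ κ)).integral_compProd ?_ fun x => ?_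
        · rw [hpi]
          refine Integrable.fintype_prod (f := fun i u => fits J A i u * if i ∈ S then h u else 1)
            fun i => ?_
          refine Integrable.bdd_mul (c := 1) ?_ (hfm i).aestronglyMeasurable (.of_forall fun u => ?_)
          · split_ifs
            · exact hhi
            · exact integrable_const _
          · rw [Real.norm_eq_abs, abs_of_nonneg (fits_nonneg ..)]
            exact fits_le_one ..
        · obtain ⟨ν, h1, h2⟩ := hν x
          have := fun i => (h1 i).1
          simp only [F]
          rw [integral_const_mul, h2, Finset.prod_mul_distrib]
          refine mul_le_mul_of_nonneg_left ?_ (hfb x).1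
          rw [integral_fintype_prod_eq_prod
            (f := fun i r => if i ∈ S then Real.exp (s * (clip r - q)) else 1)]
          refine Finset.prod_le_prod (fun i _ => integral_nonneg fun r => ?_) fun i _ => ?_
          · simp only [Pi.zero_apply]; split_ifs <;> positivity
          · split_ifs
            · refine (integral_exp_clip_le (ν i) (h1 i).2.1 s q).trans ?_
              rw [(h1 i).2.2]
            · simp
    _ = ∏ i, ∫ u, (fits J A i u * if i ∈ S then h u else 1) := by
        rw [hpi, integral_fintype_prod_eq_prod
          (f := fun i u => fits J A i u * if i ∈ S then h u else 1)]
    _ ≤ ∏ i, ((∫ u, fits J A i u) * if i ∈ S then Real.exp (s ^ 2 / 8) else 1) := by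
        refine Finset.prod_le_prod (fun i _ => integral_nonneg fun u => ?_) fun i _ => ?_
        · refine mul_nonneg (fits_nonneg ..) ?_
          split_ifs
          · exact hh0 u
          · exact zero_le_one
        · split_ifs with hi
          · have e1 : fits J A i = J.indicator 1 := by
              ext u; simp [fits, hS hi, Set.indicator_apply]
            have e2 : ∀ u, J.indicator 1 u * h u = J.indicator h u := fun u => by
              by_cases hu : u ∈ J <;> simp [hu]
            have hmi : IntegrableOn m J := by
              refine (Integrable.of_mem_Icc 0 1 hm.aemeasurable (.of_forall hm01)).integrableOn
            simp_rw [e1, e2]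
            rw [integral_indicator hJ, integral_indicator_one hJ]
            simp only [h]
            -- Since the chord bound is affine in m, averaging over J replaces m by q and yields the
            -- moment generating function of a Bernoulli(q) variable.
            rw [integral_const_mul, integral_one_sub_add_mul hmi, hq]
            simp only [MeasurableSet.univ, measureReal_restrict_apply, Set.univ_inter]
            have key := one_sub_add_mul_exp_le hq0 hq1 s
            rw [Real.exp_add] at key
            calc Real.exp (-(s * q)) * ((volume : Measure I).real J
                  - (volume : Measure I).real J * q + (volume : Measure I).real J * q * Real.exp s)
                = (volume : Measure I).real J *
                  (Real.exp (-(s * q)) * (1 - q + q * Real.exp s)) := by ring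
              _ ≤ (volume : Measure I).real J *
                  (Real.exp (-(s * q)) * (Real.exp (s * q) * Real.exp (s ^ 2 / 8))) := by gcongr
              _ = _ := by rw [← mul_assoc (Real.exp _), ← Real.exp_add]; simp
          · simp
    _ = (∫ ω, ∏ i, fits J A i (a i ω) ∂μ) * Real.exp (s ^ 2 / 8) ^ S.card := by
        rw [Finset.prod_mul_distrib]
        congr 1
        · rw [hE.indep.integral_fun_prod_comp
            (fun i => (hE.measurable_covariate i).aemeasurable)
            fun i => (hfm i).aestronglyMeasurable]
          refine Finset.prod_congr rfl fun i _ => ?_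
          rw [← hE.uniform i, integral_map (hE.measurable_covariate i).aemeasurable
            (hfm i).aestronglyMeasurable]
        · simp [Finset.prod_ite_mem]

end Moments

/-! ### Uniform sampling without replacement along a filtration -/

/-- Expected product of the weights `v` along `n` uniform draws without replacement from `R`
(it vanishes if `R` has fewer than `n` elements). -/
def avgProd {N : ℕ} (v : Fin N → ℝ) : ℕ → Finset (Fin N) → ℝ
  | 0, _ => 1
  | n + 1, R => (∑ i ∈ R, v i * avgProd v n (R.erase i)) / R.card

/-- Number of rounds before `t` at which an arm of `A` was pulled. -/
def pullCount {N : ℕ} (A : Finset (Fin N)) (h : ℕ → Fin N) (t : ℕ) : ℕ :=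
  {s ∈ Finset.range t | h s ∈ A}.card

/-- Product of the weights of the arms of `A` pulled before round `t`, limited to the first `n` pulls
in `A`. -/
def pulledProd {N : ℕ} (A : Finset (Fin N)) (v : Fin N → ℝ) (h : ℕ → Fin N) (n t : ℕ) : ℝ :=
  ∏ s ∈ Finset.range t, if h s ∈ A ∧ pullCount A h s < n then v (h s) else 1

/-- The arms of `A` not pulled before round `t`. -/
def unpulled {N : ℕ} (A : Finset (Fin N)) (h : ℕ → Fin N) (t : ℕ) : Finset (Fin N) :=
  {i ∈ A | ∀ s < t, h s ≠ i}

/-- The sampling martingale: the expected product of the weights of the first `n` arms pulled in `A`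
if sampling in `A` continues uniformly without replacement after round `t`. -/
def samplingProcess {N : ℕ} (A : Finset (Fin N)) (n t : ℕ) (h : ℕ → Fin N) (v : Fin N → ℝ) : ℝ :=
  pulledProd A v h n t * avgProd v (n - pullCount A h t) (unpulled A h t)

/-! ### Pathwise identities and bounds for the sampling process. -/

section Path

variable {N : ℕ} {A : Finset (Fin N)} {v : Fin N → ℝ} {h h' : ℕ → Fin N} {n t : ℕ}

theorem pullCount_congr (H : ∀ s < t, h s = h' s) : pullCount A h t = pullCount A h' t := by
  unfold pullCount
  congr 1
  refine Finset.filter_congr fun s hs => ?_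
  rw [H s (Finset.mem_range.1 hs)]

theorem pulledProd_congr (H : ∀ s < t, h s = h' s) :
    pulledProd A v h n t = pulledProd A v h' n t := by
  unfold pulledProd
  refine Finset.prod_congr rfl fun s hs => ?_
  have hs := Finset.mem_range.1 hs
  rw [H s hs, pullCount_congr fun r hr => H r (hr.trans hs)]

theorem unpulled_congr (H : ∀ s < t, h s = h' s) : unpulled A h t = unpulled A h' t := by
  unfold unpulled
  refine Finset.filter_congr fun i _ => ?_
  exact forall₂_congr fun s hs => by rw [H s hs]

theorem samplingProcess_congr (H : ∀ s < t, h s = h' s) :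
    samplingProcess A n t h v = samplingProcess A n t h' v := by
  unfold samplingProcess
  rw [pullCount_congr H, pulledProd_congr H, unpulled_congr H]

theorem pullCount_succ : pullCount A h (t + 1) = pullCount A h t + if h t ∈ A then 1 else 0 := by
  unfold pullCount
  rw [Finset.range_add_one, Finset.filter_insert]
  split_ifs with hA
  · rw [Finset.card_insert_of_notMem (by simp)]
  · rfl

theorem pulledProd_succ : pulledProd A v h n (t + 1) =
    pulledProd A v h n t * if h t ∈ A ∧ pullCount A h t < n then v (h t) else 1 := by
  unfold pulledProd
  rw [Finset.prod_range_succ]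

theorem unpulled_succ : unpulled A h (t + 1) = (unpulled A h t).erase (h t) := by
  ext i
  simp only [unpulled, Finset.mem_filter, Finset.mem_erase, Nat.lt_succ_iff_lt_or_eq]
  constructor
  · rintro ⟨h1, h2⟩
    exact ⟨fun e => h2 t (Or.inr rfl) e.symm, h1, fun s hs => h2 s (Or.inl hs)⟩
  · rintro ⟨h1, h2, h3⟩
    refine ⟨h2, ?_⟩
    rintro s (hs | rfl)
    · exact h3 s hs
    · exact fun e => h1 e.symm

theorem pullCount_mono {s t : ℕ} (hst : s ≤ t) : pullCount A h s ≤ pullCount A h t := by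
  refine Finset.card_le_card (Finset.filter_subset_filter _ ?_)
  exact Finset.range_subset_range.2 hst

theorem samplingProcess_succ_of_notMem (hA : h t ∉ A) :
    samplingProcess A n (t + 1) h v = samplingProcess A n t h v := by
  have : h t ∉ unpulled A h t := fun hh => hA (Finset.mem_filter.1 hh).1
  simp [samplingProcess, pullCount_succ, pulledProd_succ, unpulled_succ, hA,
    Finset.erase_eq_of_notMem this]

theorem samplingProcess_succ_of_mem (hA : h t ∈ A) :
    samplingProcess A n (t + 1) h v = pulledProd A v h n t *
      if pullCount A h t < n then
        v (h t) * avgProd v (n - pullCount A h t - 1) ((unpulled A h t).erase (h t)) else 1 := by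
  unfold samplingProcess
  rw [pullCount_succ, pulledProd_succ, unpulled_succ]
  simp only [hA, true_and, if_true]
  split_ifs with hc
  · rw [mul_assoc, Nat.sub_sub]
  · rw [Nat.sub_eq_zero_of_le (by omega)]
    simp [avgProd]

/-- One uniform draw, either from the unpulled arms of `A` or outside `A`, preserves the expectation
of the sampling process. -/
theorem sum_samplingProcess_update (R : Finset (Fin N)) (hR : R.Nonempty)
    (hRA : R = unpulled A h t ∨ Disjoint R A) :
    ∑ i, samplingProcess A n (t + 1) (Function.update h t i) v *
      (if i ∈ R then (R.card : ℝ)⁻¹ else 0) = samplingProcess A n t h v := by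
  have hc : (R.card : ℝ) ≠ 0 := by simpa using hR.ne_empty
  have hupd : ∀ i, ∀ s < t, Function.update h t i s = h s := fun i s hs =>
    Function.update_of_ne hs.ne _ _
  simp only [mul_ite, mul_zero, Finset.sum_ite_mem, Finset.univ_inter]
  rcases hRA with hRA | hRA
  · have hstep : ∀ i ∈ R, samplingProcess A n (t + 1) (Function.update h t i) v =
        pulledProd A v h n t * if pullCount A h t < n then
          v i * avgProd v (n - pullCount A h t - 1) (R.erase i) else 1 := fun i hi => by
      have hi' : Function.update h t i t ∈ A := by
        rw [Function.update_self]
        rw [hRA] at hi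
        exact (Finset.mem_filter.1 hi).1
      rw [samplingProcess_succ_of_mem hi', pullCount_congr (hupd i), pulledProd_congr (hupd i),
        unpulled_congr (hupd i), Function.update_self, hRA]
    rw [Finset.sum_congr rfl fun i hi => by rw [hstep i hi]]
    unfold samplingProcess
    rw [← hRA]
    split_ifs with hlt
    · obtain ⟨j, hj⟩ := Nat.exists_eq_add_of_lt hlt
      have e1 : n - pullCount A h t = j + 1 := by omega
      have e2 : n - pullCount A h t - 1 = j := by omega
      rw [e2, e1, avgProd, div_eq_mul_inv, Finset.sum_mul, Finset.mul_sum]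
      exact Finset.sum_congr rfl fun i _ => by ring
    -- After n pulls in A the truncated difference is 0, so no weight enters any more.
    · rw [Nat.sub_eq_zero_of_le (by omega)]
      simp [avgProd]
      field_simp
  · have hstep : ∀ i ∈ R, samplingProcess A n (t + 1) (Function.update h t i) v =
        samplingProcess A n t h v := fun i hi => by
      rw [samplingProcess_succ_of_notMem, samplingProcess_congr (hupd i)]
      rw [Function.update_self]
      exact Finset.disjoint_left.1 hRA hi
    rw [Finset.sum_congr rfl fun i hi => by rw [hstep i hi]]
    simp
    field_simp

/-- If exactly `n` arms of `A` were pulled before `t`, the process is frozen from `t` on. -/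
theorem samplingProcess_of_pullCount_eq {T : ℕ} (hn : pullCount A h t = n) (htT : t ≤ T) :
    samplingProcess A n T h v = ∏ s ∈ Finset.range t with h s ∈ A, v (h s) := by
  induction T, htT using Nat.le_induction with
  | base =>
    unfold samplingProcess pulledProd
    rw [hn, Nat.sub_self, avgProd, mul_one, Finset.prod_filter]
    refine Finset.prod_congr rfl fun s hs => ?_
    have hs := Finset.mem_range.1 hs
    by_cases hA : h s ∈ A
    · have := pullCount_mono (A := A) (h := h) (Nat.succ_le_of_lt hs)
      rw [Nat.succ_eq_add_one, pullCount_succ, if_pos hA, hn] at this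
      rw [if_pos ⟨hA, by omega⟩, if_pos hA]
    · rw [if_neg (fun hh => hA hh.1), if_neg hA]
  | succ T htT ih =>
    by_cases hA : h T ∈ A
    · rw [← ih, samplingProcess_succ_of_mem hA, samplingProcess]
      have := pullCount_mono (A := A) (h := h) htT
      rw [if_neg (by omega), Nat.sub_eq_zero_of_le (by omega), avgProd]
    · rw [samplingProcess_succ_of_notMem hA, ih]

theorem samplingProcess_zero : samplingProcess A n 0 h v = avgProd v n A := by
  simp [samplingProcess, pulledProd, pullCount, unpulled]

theorem avgProd_mem {B : ℝ} (hB : 1 ≤ B) (hv : ∀ i, v i ∈ Set.Icc 0 B) (n : ℕ)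
    (R : Finset (Fin N)) : avgProd v n R ∈ Set.Icc 0 (B ^ n) := by
  have hB0 : 0 ≤ B := zero_le_one.trans hB
  induction n generalizing R with
  | zero => simp [avgProd]
  | succ n ih =>
    rw [avgProd]
    refine ⟨div_nonneg (Finset.sum_nonneg fun i _ => mul_nonneg (hv i).1 (ih _).1)
      (Nat.cast_nonneg _), ?_⟩
    refine div_le_of_le_mul₀ (Nat.cast_nonneg _) (by positivity) ?_
    calc ∑ i ∈ R, v i * avgProd v n (R.erase i) ≤ ∑ _i ∈ R, B ^ (n + 1) := by
          refine Finset.sum_le_sum fun i _ => ?_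
          rw [pow_succ']
          exact mul_le_mul (hv i).2 (ih _).2 (ih _).1 hB0
      _ = _ := by simp [mul_comm]

theorem samplingProcess_mem {B : ℝ} (hB : 1 ≤ B) (hv : ∀ i, v i ∈ Set.Icc 0 B) :
    samplingProcess A n t h v ∈ Set.Icc 0 (B ^ t * B ^ n) := by
  have hB0 : 0 ≤ B := zero_le_one.trans hB
  have h1 := avgProd_mem hB hv (n - pullCount A h t) (unpulled A h t)
  have h2 : ∀ s, 0 ≤ (if h s ∈ A ∧ pullCount A h s < n then v (h s) else 1) := fun s => by
    split_ifs
    · exact (hv _).1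
    · exact zero_le_one
  have h3 : 0 ≤ pulledProd A v h n t := Finset.prod_nonneg fun s _ => h2 s
  have h4 : pulledProd A v h n t ≤ B ^ t := by
    refine (Finset.prod_le_prod (fun s _ => h2 s) (g := fun _ => B) fun s _ => ?_).trans (by simp)
    split_ifs
    · exact (hv _).2
    · exact hB
  refine ⟨mul_nonneg h3 h1.1, ?_⟩
  refine mul_le_mul h4 (h1.2.trans ?_) h1.1 (by positivity)
  exact pow_le_pow_right₀ hB (Nat.sub_le _ _)

theorem measurable_avgProd (n : ℕ) (R : Finset (Fin N)) :
    Measurable fun v : Fin N → ℝ => avgProd v n R := by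
  induction n generalizing R with
  | zero => simp [avgProd]
  | succ n ih =>
    simp only [avgProd]
    exact (Finset.measurable_sum _ fun i _ => (measurable_pi_apply i).mul (ih _)).div_const _

theorem measurable_samplingProcess (A : Finset (Fin N)) (n t : ℕ) (h : ℕ → Fin N) :
    Measurable (samplingProcess A n t h) := by
  unfold samplingProcess pulledProd
  refine Measurable.mul (Finset.measurable_prod _ fun s _ => ?_) (measurable_avgProd _ _)
  split_ifs
  · exact measurable_pi_apply _
  · exact measurable_const

end Path

/-- A function of the environment and of the arms pulled before round `t` is measurable with respect
to the information available at round `t`. -/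
theorem measurable_of_history {Ω : Type*} {mΩ : MeasurableSpace Ω} {N : ℕ} {t : ℕ}
    {φ : ℕ → Ω → Fin N} {v : Ω → Fin N → ℝ} (F : (ℕ → Fin N) → (Fin N → ℝ) → ℝ)
    (hF : ∀ h, Measurable (F h)) (hloc : ∀ h h' w, (∀ s < t, h s = h' s) → F h w = F h' w)
    (hφ : ∀ s < t, Measurable (φ s)) (hv : Measurable v) :
    Measurable fun ω => F (fun s => φ s ω) (v ω) := by
  rcases isEmpty_or_nonempty Ω with hΩ | ⟨⟨ω₀⟩⟩
  · exact measurable_of_empty _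
  -- Histories before t form a finite discrete space, so measurability is checked one history at a
  -- time. By `hloc` the later values are irrelevant; any available arm fills them.
  let ext : (Fin t → Fin N) → ℕ → Fin N := fun g s => if hs : s < t then g ⟨s, hs⟩ else φ 0 ω₀
  have hG : Measurable fun p : (Fin t → Fin N) × (Fin N → ℝ) => F (ext p.1) p.2 :=
    measurable_from_prod_countable_right fun g => hF (ext g)
  have hhist : Measurable fun ω => ((fun s : Fin t => φ s ω), v ω) :=
    (measurable_pi_lambda _ fun s : Fin t => hφ s s.2).prodMk hv
  have := hG.comp hhist
  convert this using 2 with ω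
  refine hloc _ _ _ fun s hs => ?_
  simp [ext, hs]

/-! ### Constancy of the expectation of the sampling process. -/

section Sampling

variable {Ω : Type*} [mΩ : MeasurableSpace Ω] {μ : Measure Ω} [IsProbabilityMeasure μ] {N : ℕ}

/-- Along a filtration such that, on the event `E`, each arm is drawn uniformly from a set which is
either the set of unpulled arms of `A` or disjoint from `A`, the sampling process has constant
expectation. -/
theorem integral_samplingProcess (ℱ : Filtration ℕ mΩ) {φ : ℕ → Ω → Fin N} {v : Ω → Fin N → ℝ}
    {A : Finset (Fin N)} {E : Set Ω} {T : ℕ} (n : ℕ) (R : ℕ → Ω → Finset (Fin N)) {B : ℝ}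
    (hB : 1 ≤ B) (hvB : ∀ ω i, v ω i ∈ Set.Icc 0 B) (hE : MeasurableSet[ℱ 0] E)
    (hv : Measurable[ℱ 0] v) (hφ : ∀ t < T, Measurable[ℱ (t + 1)] (φ t))
    (hR : ∀ t < T, ∀ᵐ ω ∂μ, ω ∈ E → (R t ω).Nonempty ∧
      (R t ω = unpulled A (fun s => φ s ω) t ∨ Disjoint (R t ω) A))
    (hcond : ∀ t < T, ∀ i, μ[Set.indicator {ω | φ t ω = i} (fun _ => (1 : ℝ)) | ℱ t] =ᵐ[μ]
      fun ω => if i ∈ R t ω then ((R t ω).card : ℝ)⁻¹ else 0) :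
    ∫ ω in E, samplingProcess A n T (fun s => φ s ω) (v ω) ∂μ =
      ∫ ω in E, avgProd (v ω) n A ∂μ := by
  suffices H : ∀ t ≤ T, ∫ ω in E, samplingProcess A n t (fun s => φ s ω) (v ω) ∂μ =
      ∫ ω in E, avgProd (v ω) n A ∂μ from H T le_rfl
  intro t
  induction t with
  | zero => intro _; simp_rw [samplingProcess_zero]
  | succ t ih =>
    intro ht
    rw [← ih (by omega)]
    have htT : t < T := ht
    have hEt : MeasurableSet[ℱ t] E := ℱ.mono (Nat.zero_le t) _ hE
    have hE' : MeasurableSet E := ℱ.le 0 _ hE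
    -- The value at t + 1 if arm i were drawn at round t. It is known at round t, so it can be
    -- pulled out of the conditional expectation of the indicator of that draw.
    let G : Fin N → Ω → ℝ := fun i ω =>
      E.indicator (fun ω => samplingProcess A n (t + 1) (Function.update (fun s => φ s ω) t i) (v ω)) ω
    have hGm : ∀ i, Measurable[ℱ t] (G i) := fun i => by
      refine Measurable.indicator ?_ hEt
      refine @measurable_of_history Ω (ℱ t) N t φ v
        (fun h w => samplingProcess A n (t + 1) (Function.update h t i) w)
        (fun h => measurable_samplingProcess _ _ _ _) ?_ ?_ ?_
      · intro h h' w hh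
        refine samplingProcess_congr fun s hs => ?_
        rcases Nat.lt_succ_iff_lt_or_eq.1 hs with hs | rfl
        · rw [Function.update_of_ne hs.ne, Function.update_of_ne hs.ne, hh s hs]
        · rw [Function.update_self, Function.update_self]
      · exact fun s hs => (hφ s (hs.trans htT)).mono (ℱ.mono hs) le_rfl
      · exact hv.mono (ℱ.mono (Nat.zero_le t)) le_rfl
    have hGb : ∀ i ω, ‖G i ω‖ ≤ B ^ (t + 1) * B ^ n := fun i ω => by
      by_cases hωE : ω ∈ E
      · simp only [G, Set.indicator_of_mem hωE]
        have := samplingProcess_mem (A := A) (n := n) (t := t + 1)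
          (h := Function.update (fun s => φ s ω) t i) hB (hvB ω)
        rw [Real.norm_eq_abs, abs_of_nonneg this.1]
        exact this.2
      · simp only [G, Set.indicator_of_notMem hωE, norm_zero]
        positivity
    have hφm : ∀ i, MeasurableSet {ω | φ t ω = i} := fun i =>
      ((hφ t htT).mono (ℱ.le _) le_rfl) (measurableSet_singleton i)
    have hξi : ∀ i, Integrable (Set.indicator {ω | φ t ω = i} (fun _ => (1 : ℝ))) μ := fun i =>
      (integrable_const 1).indicator (hφm i)
    have hGξ : ∀ i, Integrable (G i * Set.indicator {ω | φ t ω = i} (fun _ => (1 : ℝ))) μ :=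
      fun i => (hξi i).bdd_mul ((hGm i).mono (ℱ.le t) le_rfl).aestronglyMeasurable
        (.of_forall (hGb i))
    have hpull : ∀ i, ∫ ω, G i ω * Set.indicator {ω | φ t ω = i} (fun _ => (1 : ℝ)) ω ∂μ =
        ∫ ω, G i ω * (if i ∈ R t ω then ((R t ω).card : ℝ)⁻¹ else 0) ∂μ := fun i => by
      have h1 := condExp_mul_of_stronglyMeasurable_left (hGm i).stronglyMeasurable (hGξ i) (hξi i)
      have h2 := integral_condExp (ℱ.le t) (f := G i * Set.indicator {ω | φ t ω = i}
        (fun _ => (1 : ℝ))) (μ := μ)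
      simp only [Pi.mul_apply] at h2
      rw [← h2]
      refine integral_congr_ae ?_
      filter_upwards [h1, hcond t htT i] with ω h3 h4
      rw [h3, Pi.mul_apply, h4]
    have hGq : ∀ i, Integrable (fun ω => G i ω * (if i ∈ R t ω then ((R t ω).card : ℝ)⁻¹ else 0))
        μ := fun i => by
      refine (integrable_condExp (m := ℱ t) (f := G i * Set.indicator {ω | φ t ω = i}
        (fun _ => (1 : ℝ))) (μ := μ)).congr ?_
      filter_upwards [condExp_mul_of_stronglyMeasurable_left (hGm i).stronglyMeasurable (hGξ i)
        (hξi i), hcond t htT i] with ω h3 h4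
      rw [h3, Pi.mul_apply, h4]
    rw [← integral_indicator hE', ← integral_indicator hE']
    calc ∫ ω, E.indicator (fun ω => samplingProcess A n (t + 1) (fun s => φ s ω) (v ω)) ω ∂μ
        = ∫ ω, ∑ i, G i ω * Set.indicator {ω | φ t ω = i} (fun _ => (1 : ℝ)) ω ∂μ := by
          refine integral_congr_ae (.of_forall fun ω => ?_)
          by_cases hωE : ω ∈ E
          · simp [G, hωE, Set.indicator_apply]
          · simp [G, hωE]
      _ = ∑ i, ∫ ω, G i ω * Set.indicator {ω | φ t ω = i} (fun _ => (1 : ℝ)) ω ∂μ :=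
          integral_finsetSum _ fun i _ => hGξ i
      _ = ∑ i, ∫ ω, G i ω * (if i ∈ R t ω then ((R t ω).card : ℝ)⁻¹ else 0) ∂μ :=
          Finset.sum_congr rfl fun i _ => hpull i
      _ = ∫ ω, ∑ i, G i ω * (if i ∈ R t ω then ((R t ω).card : ℝ)⁻¹ else 0) ∂μ :=
          (integral_finsetSum _ fun i _ => hGq i).symm
      _ = _ := by
          refine integral_congr_ae ?_
          filter_upwards [hR t htT] with ω hω
          by_cases hωE : ω ∈ E
          · simp only [G, Set.indicator_of_mem hωE]
            exact sum_samplingProcess_update _ (hω hωE).1 (hω hωE).2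
          · simp [G, Set.indicator_of_notMem hωE]

end Sampling

/-! ### Cells -/

theorem eq_of_mem_cell {K : ℕ} {k l : Fin K} {x : I} (hk : x ∈ cell K k) (hl : x ∈ cell K l) :
    k = l := by
  have key : ∀ {k l : Fin K}, x ∈ cell K k → x ∈ cell K l → ¬ k < l := fun {k l} hk hl hkl => by
    have hK : (0 : ℝ) < K := by exact_mod_cast (Nat.zero_le _).trans_lt k.2
    have h1 : (k : ℕ) + 1 ≤ l := hkl
    rcases hk.2 with h | h
    · have h2 := h.trans_le' hl.1
      rw [div_lt_div_iff_of_pos_right hK] at h2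
      have : (l : ℕ) < k + 1 := by exact_mod_cast h2
      omega
    · have := l.2
      omega
  rcases lt_trichotomy k l with h | h | h
  · exact absurd h (key hk hl)
  · exact h
  · exact absurd h (key hl hk)

theorem exists_mem_cell {K : ℕ} (hK : 0 < K) (x : I) : ∃ k : Fin K, x ∈ cell K k := by
  have hK' : (0 : ℝ) < K := by exact_mod_cast hK
  have hx0 : 0 ≤ (x : ℝ) * K := mul_nonneg x.2.1 hK'.le
  by_cases h : ⌊(x : ℝ) * K⌋₊ < K
  · refine ⟨⟨_, h⟩, ?_, Or.inl ?_⟩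
    · rw [div_le_iff₀ hK']
      exact Nat.floor_le hx0
    · rw [lt_div_iff₀ hK']
      exact Nat.lt_floor_add_one _
  -- The floor reaches K only at x = 1, which the closed last cell contains.
  · refine ⟨⟨K - 1, by omega⟩, ?_, Or.inr (by simp; omega)⟩
    rw [div_le_iff₀ hK']
    have h1 : (K : ℝ) ≤ x * K := (Nat.cast_le.2 (not_lt.1 h)).trans (Nat.floor_le hx0)
    refine le_trans ?_ h1
    exact_mod_cast Nat.sub_le K 1

theorem measurableSet_cell (K : ℕ) (k : Fin K) : MeasurableSet (cell K k) := by
  unfold cell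
  refine MeasurableSet.inter (measurableSet_le measurable_const measurable_subtype_coe) ?_
  exact (measurableSet_lt measurable_subtype_coe measurable_const).union (MeasurableSet.const _)

theorem volume_cell {K : ℕ} (k : Fin K) : (volume : Measure I).real (cell K k) = 1 / K := by
  have hk := k.2
  have hK' : (0 : ℝ) < K := by exact_mod_cast (Nat.zero_le _).trans_lt hk
  have h0 : (0 : ℝ) ≤ k / K := by positivity
  have h1 : (k : ℝ) / K ≤ 1 := by
    rw [div_le_one hK']; exact_mod_cast hk.le
  by_cases h : (k : ℕ) + 1 = K
  · have : cell K k = Set.Ici ⟨k / K, h0, h1⟩ := by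
      ext x; simp [cell, h, ← Subtype.coe_le_coe]
    rw [this, measureReal_def, unitInterval.volume_Ici, ENNReal.toReal_ofReal (by simp [h1])]
    have : (k : ℝ) + 1 = K := by exact_mod_cast h
    simp only
    rw [eq_div_iff hK'.ne', sub_mul, div_mul_cancel₀ _ hK'.ne']
    linarith
  · have h2 : ((k : ℝ) + 1) / K ≤ 1 := by
      rw [div_le_one hK']; exact_mod_cast hk
    have : cell K k = Set.Ico ⟨k / K, h0, h1⟩ ⟨((k : ℝ) + 1) / K, by positivity, h2⟩ := by
      ext x; simp [cell, h, ← Subtype.coe_le_coe, ← Subtype.coe_lt_coe]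
    rw [this, measureReal_def, unitInterval.volume_Ico, ENNReal.toReal_ofReal]
    · simp only; ring
    · simp only; rw [add_div, add_sub_cancel_left]; positivity

theorem abs_sub_le_of_mem_cell {K : ℕ} {k : Fin K} {x y : I} (hx : x ∈ cell K k)
    (hy : y ∈ cell K k) : |(x : ℝ) - y| ≤ 1 / K := by
  have hK' : (0 : ℝ) < K := by exact_mod_cast (Nat.zero_le _).trans_lt k.2
  have up : ∀ {z : I}, z ∈ cell K k → (z : ℝ) ≤ (k + 1) / K := fun {z} hz => by
    rcases hz.2 with h | h
    · exact h.le
    · have : (k : ℝ) + 1 = K := by exact_mod_cast h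
      rw [this, div_self hK'.ne']
      exact z.2.2
  have h1 := hx.1
  have h2 := hy.1
  have h3 := up hx
  have h4 := up hy
  rw [add_div] at h3 h4
  rw [abs_le]
  constructor <;> linarith

theorem cell_nonempty {K : ℕ} (k : Fin K) : (cell K k).Nonempty := by
  by_contra h
  have hK' : (0 : ℝ) < K := by exact_mod_cast (Nat.zero_le _).trans_lt k.2
  have := volume_cell k
  rw [Set.not_nonempty_iff_eq_empty.1 h, measureReal_empty] at this
  have : (0 : ℝ) < 1 / K := by positivity
  linarith

/-- Mean reward of a cell. -/
def cellMean (m : I → ℝ) {K : ℕ} (k : Fin K) : ℝ := K * ∫ u in cell K k, m u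

theorem setIntegral_cell (m : I → ℝ) {K : ℕ} (k : Fin K) :
    ∫ u in cell K k, m u = (volume : Measure I).real (cell K k) * cellMean m k := by
  have hK' : (K : ℝ) ≠ 0 := by exact_mod_cast ((Nat.zero_le _).trans_lt k.2).ne'
  rw [volume_cell, cellMean]
  field_simp

section CellMean

variable {m : I → ℝ} (hm : Measurable m) (hm01 : ∀ x, m x ∈ Set.Icc (0 : ℝ) 1) {K : ℕ} {k : Fin K}
include hm hm01

theorem cellMean_le {c : ℝ} (h : ∀ x ∈ cell K k, m x ≤ c) : cellMean m k ≤ c := by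
  have hK' : (0 : ℝ) < K := by exact_mod_cast (Nat.zero_le _).trans_lt k.2
  have hi : Integrable m := Integrable.of_mem_Icc 0 1 hm.aemeasurable (.of_forall hm01)
  have := setIntegral_mono_on hi.integrableOn (integrableOn_const (C := c) (measure_ne_top _ _))
    (measurableSet_cell K k) h
  rw [setIntegral_const, setIntegral_cell, smul_eq_mul, volume_cell] at this
  exact le_of_mul_le_mul_left this (by positivity)

theorem le_cellMean {c : ℝ} (h : ∀ x ∈ cell K k, c ≤ m x) : c ≤ cellMean m k := by
  have hK' : (0 : ℝ) < K := by exact_mod_cast (Nat.zero_le _).trans_lt k.2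
  have hi : Integrable m := Integrable.of_mem_Icc 0 1 hm.aemeasurable (.of_forall hm01)
  have := setIntegral_mono_on (integrableOn_const (C := c) (measure_ne_top _ _)) hi.integrableOn
    (measurableSet_cell K k) h
  rw [setIntegral_const, setIntegral_cell, smul_eq_mul, volume_cell] at this
  exact le_of_mul_le_mul_left this (by positivity)

end CellMean

/-! ### Concentration of the empirical means -/

theorem mem_armsIn {N K : ℕ} {x : Fin N → I} {k : Fin K} {i : Fin N} :
    i ∈ armsIn x k ↔ x i ∈ cell K k := by simp [armsIn]

theorem remaining_eq_unpulled {N K : ℕ} (x : Fin N → I) (φ : ℕ → Fin N) (t : ℕ) (k : Fin K) :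
    remaining x φ t k = unpulled (armsIn x k) φ t := by
  ext i; simp [remaining, unpulled]

theorem card_pulls {N K : ℕ} (x : Fin N → I) (φ : ℕ → Fin N) (t : ℕ) (k : Fin K) :
    (pulls x φ t k).card = pullCount (armsIn x k) φ t := by
  unfold pulls pullCount
  congr 1
  ext s
  simp [mem_armsIn]

section Concentration

variable {Ω : Type*} [mΩ : MeasurableSpace Ω] {μ : Measure Ω} [IsProbabilityMeasure μ] {N : ℕ}
  {m : I → ℝ} {a : Fin N → Ω → I} {y : Fin N → Ω → ℝ}

theorem ae_reward_mem (hE : IsEnvironment μ m a y) : ∀ᵐ ω ∂μ, ∀ i, y i ω ∈ Set.Icc (0 : ℝ) 1 := by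
  obtain ⟨κ, hκ, hd, hν⟩ := hE.rewards
  have hs : MeasurableSet {p : (Fin N → I) × (Fin N → ℝ) | ∀ i, p.2 i ∈ Set.Icc (0 : ℝ) 1} := by
    rw [Set.ofPred_forall]
    exact MeasurableSet.iInter fun i =>
      ((measurable_pi_apply i).comp measurable_snd) measurableSet_Icc
  have hmeasa : Measurable fun ω i => a i ω := measurable_pi_lambda _ hE.measurable_covariate
  have hprob : IsProbabilityMeasure (μ.map fun ω i => a i ω) :=
    Measure.isProbabilityMeasure_map hmeasa.aemeasurable
  have h1 : ∀ᵐ p ∂((μ.map fun ω i => a i ω) ⊗ₘ κ), ∀ i, p.2 i ∈ Set.Icc (0 : ℝ) 1 := by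
    rw [Measure.ae_compProd_iff hs]
    refine .of_forall fun x => ?_
    obtain ⟨ν, h1, h2⟩ := hν x
    have := fun i => (h1 i).1
    rw [h2, ae_all_iff]
    exact fun i => (Measure.quasiMeasurePreserving_eval ν i).ae (h1 i).2.1
  rw [← hd.map_eq, ae_map_iff hd.aemeasurable hs] at h1
  exact h1

/-- Exponential weights of the arms. -/
def expWeight (s q : ℝ) (r : Fin N → ℝ) (i : Fin N) : ℝ := Real.exp (s * (clip (r i) - q))

theorem expWeight_mem {s q : ℝ} (r : Fin N → ℝ) (i : Fin N) :
    expWeight s q r i ∈ Set.Icc 0 (Real.exp (|s| * (1 + |q|))) := by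
  refine ⟨(Real.exp_pos _).le, ?_⟩
  rw [expWeight, Real.exp_le_exp]
  refine (le_abs_self _).trans ?_
  rw [abs_mul]
  gcongr
  refine (abs_sub _ _).trans ?_
  gcongr
  rw [abs_of_nonneg (clip_nonneg _)]
  exact clip_le_one _

theorem one_le_exp_bound (s q : ℝ) : 1 ≤ Real.exp (|s| * (1 + |q|)) :=
  Real.one_le_exp (by positivity)

theorem measurable_expWeight (s q : ℝ) : Measurable (expWeight (N := N) s q) := by
  have := measurable_clip
  unfold expWeight
  fun_prop

theorem prod_fits (J : Set I) (A : Finset (Fin N)) (x : Fin N → I) :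
    ∏ i, fits J A i (x i) = {x : Fin N → I | ∀ i, x i ∈ J ↔ i ∈ A}.indicator (fun _ => 1) x := by
  classical
  by_cases h : ∀ i, x i ∈ J ↔ i ∈ A
  · rw [Set.indicator_of_mem (by exact h)]
    exact Finset.prod_eq_one fun i _ => by simp [fits, h i]
  · rw [Set.indicator_of_notMem (by exact h)]
    push Not at h
    obtain ⟨i, hi⟩ := h
    refine Finset.prod_eq_zero (Finset.mem_univ i) ?_
    rw [fits, if_neg]
    intro h'
    rcases hi with hi | hi
    · exact hi.2 (h'.1 hi.1)
    · exact hi.1 (h'.2 hi.2)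

/-- Induction on the number of draws, each of which moves an arm from R to S; at the end every
product runs over a fixed subset of A. The set S is arbitrary for the sake of this induction. If R
runs out of arms, the average vanishes. -/
theorem integral_avgProd_le (hE : IsEnvironment μ m a y) (hm : Measurable m)
    (hm01 : ∀ x, m x ∈ Set.Icc (0 : ℝ) 1) {J : Set I} (hJ : MeasurableSet J) {q : ℝ}
    (hq0 : 0 ≤ q) (hq1 : q ≤ 1) (hq : ∫ u in J, m u = (volume : Measure I).real J * q) (s : ℝ)
    {A : Finset (Fin N)} (n : ℕ) {S R : Finset (Fin N)} (hS : S ⊆ A) (hR : R ⊆ A)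
    (hSR : Disjoint S R) :
    ∫ ω, (∏ i, fits J A i (a i ω)) * ((∏ i ∈ S, expWeight s q (fun i => y i ω) i) *
        avgProd (expWeight s q fun i => y i ω) n R) ∂μ ≤
      (∫ ω, ∏ i, fits J A i (a i ω) ∂μ) * Real.exp (s ^ 2 / 8) ^ (S.card + n) := by
  classical
  have hP : 0 ≤ ∫ ω, ∏ i, fits J A i (a i ω) ∂μ :=
    integral_nonneg fun ω => Finset.prod_nonneg fun i _ => fits_nonneg ..
  have hym : Measurable fun ω i => y i ω := measurable_pi_lambda _ hE.measurable_reward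
  have hwm : Measurable fun ω => expWeight s q fun i => y i ω := (measurable_expWeight s q).comp hym
  induction n generalizing S R with
  | zero =>
    simp only [avgProd, mul_one, add_zero]
    exact integral_fits_mul_prod_exp_le hE hm hm01 hJ hq0 hq1 hq s hS
  | succ n ih =>
    rcases R.eq_empty_or_nonempty with rfl | hRne
    · simp only [avgProd, Finset.sum_empty, zero_div, mul_zero, integral_zero]
      positivity
    have hRc : (0 : ℝ) < R.card := by exact_mod_cast hRne.card_pos
    have hint : ∀ i ∈ R, Integrable (fun ω => (∏ i, fits J A i (a i ω)) *
        ((∏ i ∈ insert i S, expWeight s q (fun i => y i ω) i) *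
          avgProd (expWeight s q fun i => y i ω) n (R.erase i))) μ := by
      intro i _
      set B := Real.exp (|s| * (1 + |q|)) with hB
      refine Integrable.of_bound (C := 1 * (B ^ (insert i S).card * B ^ n)) ?_
        (.of_forall fun ω => ?_)
      · refine Measurable.aestronglyMeasurable ?_
        refine Measurable.mul (Finset.measurable_prod _ fun i _ =>
          (measurable_fits hJ A i).comp (hE.measurable_covariate i)) (Measurable.mul ?_ ?_)
        · exact Finset.measurable_prod _ fun i _ => (measurable_pi_apply i).comp hwm
        · exact (measurable_avgProd n _).comp hwm
      · have h1 : 0 ≤ ∏ i, fits J A i (a i ω) := Finset.prod_nonneg fun i _ => fits_nonneg ..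
        have h2 : ∏ i, fits J A i (a i ω) ≤ 1 :=
          Finset.prod_le_one (fun i _ => fits_nonneg ..) fun i _ => fits_le_one ..
        have h3 := avgProd_mem (one_le_exp_bound s q)
          (fun i => expWeight_mem (s := s) (q := q) (fun i => y i ω) i) n (R.erase i)
        have h4 : 0 ≤ ∏ i ∈ insert i S, expWeight s q (fun i => y i ω) i :=
          Finset.prod_nonneg fun i _ => (expWeight_mem _ i).1
        have h5 : ∏ i ∈ insert i S, expWeight s q (fun i => y i ω) i ≤ B ^ (insert i S).card := by
          refine (Finset.prod_le_prod (fun i _ => (expWeight_mem _ i).1)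
            fun i _ => (expWeight_mem _ i).2).trans ?_
          simp [hB]
        rw [Real.norm_eq_abs, abs_of_nonneg (mul_nonneg h1 (mul_nonneg h4 h3.1))]
        exact mul_le_mul h2 (mul_le_mul h5 h3.2 h3.1 (by positivity)) (mul_nonneg h4 h3.1)
          zero_le_one
    have hstep : ∀ ω, (∏ i, fits J A i (a i ω)) * ((∏ i ∈ S, expWeight s q (fun i => y i ω) i) *
        avgProd (expWeight s q fun i => y i ω) (n + 1) R) =
        (R.card : ℝ)⁻¹ * ∑ i ∈ R, (∏ i, fits J A i (a i ω)) *
        ((∏ i ∈ insert i S, expWeight s q (fun i => y i ω) i) *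
          avgProd (expWeight s q fun i => y i ω) n (R.erase i)) := fun ω => by
      rw [avgProd, div_eq_inv_mul, Finset.mul_sum, Finset.mul_sum, Finset.mul_sum, Finset.mul_sum]
      refine Finset.sum_congr rfl fun i hi => ?_
      rw [Finset.prod_insert (Finset.disjoint_right.1 hSR hi)]
      ring
    simp_rw [hstep]
    rw [integral_const_mul, integral_finsetSum _ hint]
    calc _ ≤ (R.card : ℝ)⁻¹ * ∑ _i ∈ R, (∫ ω, ∏ i, fits J A i (a i ω) ∂μ) *
          Real.exp (s ^ 2 / 8) ^ (S.card + (n + 1)) := by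
          gcongr with i hi
          have hiS : i ∉ S := Finset.disjoint_right.1 hSR hi
          have := ih (S := insert i S) (R := R.erase i)
            (Finset.insert_subset (hR hi) hS) ((Finset.erase_subset _ _).trans hR) (by
              rw [Finset.disjoint_insert_left]
              exact ⟨by simp, hSR.mono_right (Finset.erase_subset _ _)⟩)
          rw [Finset.card_insert_of_notMem hiS] at this
          rwa [show S.card + (n + 1) = S.card + 1 + n by ring]
      _ = _ := by
          rw [Finset.sum_const, nsmul_eq_mul]
          field_simp

end Concentration

/-! ### Tail bounds for cell averages and arm counts. -/

section Deviation

variable {Ω : Type*} [mΩ : MeasurableSpace Ω] {μ : Measure Ω} [IsProbabilityMeasure μ] {N : ℕ}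
  {m : I → ℝ} {a : Fin N → Ω → I} {y : Fin N → Ω → ℝ} {T K : ℕ} {δ : ℝ} {φ : ℕ → Ω → Fin N}

/-- The space is partitioned by the set A of arms lying in the cell, and Markov's inequality is
applied on each piece to the sampling process at time T. The process is frozen after n pulls in A,
so the quantifier over t costs no union bound. -/
theorem measure_sum_pulls_ge_le (hE : IsEnvironment μ m a y) (hm : Measurable m)
    (hm01 : ∀ x, m x ∈ Set.Icc (0 : ℝ) 1) (hA : IsUCBF μ a y T K δ φ) (k : Fin K) (n : ℕ) (s θ : ℝ) :
    μ.real {ω | ∃ t ≤ T, (pulls (fun i => a i ω) (fun s => φ s ω) t k).card = n ∧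
      θ ≤ ∑ r ∈ pulls (fun i => a i ω) (fun s => φ s ω) t k,
        s * (clip (y (φ r ω) ω) - cellMean m k)} ≤ Real.exp (-θ) * Real.exp (s ^ 2 / 8) ^ n := by
  classical
  obtain ⟨ℱ, sel, ha, hy, hstep⟩ := hA
  set J := cell K k with hJdef
  set q := cellMean m k with hqdef
  have hJ : MeasurableSet J := measurableSet_cell K k
  have hq0 : 0 ≤ q := le_cellMean hm hm01 fun x _ => (hm01 x).1
  have hq1 : q ≤ 1 := cellMean_le hm hm01 fun x _ => (hm01 x).2
  have hq : ∫ u in J, m u = (volume : Measure I).real J * q := setIntegral_cell m k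
  set Bad := {ω | ∃ t ≤ T, (pulls (fun i => a i ω) (fun s => φ s ω) t k).card = n ∧
      θ ≤ ∑ r ∈ pulls (fun i => a i ω) (fun s => φ s ω) t k,
        s * (clip (y (φ r ω) ω) - q)} with hBad
  let E : Finset (Fin N) → Set Ω := fun A => {ω | ∀ i, a i ω ∈ J ↔ i ∈ A}
  let v : Ω → Fin N → ℝ := fun ω => expWeight s q fun i => y i ω
  have hym : Measurable[ℱ 0] fun ω i => y i ω :=
    @measurable_pi_lambda _ _ _ (ℱ 0) _ _ hy
  have hvm : Measurable[ℱ 0] v :=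
    @Measurable.comp _ _ _ (ℱ 0) _ _ _ _ (measurable_expWeight s q) hym
  have hEm : ∀ A, MeasurableSet[ℱ 0] (E A) := fun A => by
    simp only [E, Set.ofPred_forall]
    refine MeasurableSet.iInter fun i => ?_
    by_cases hi : i ∈ A
    · simp only [hi, iff_true]
      exact ha i hJ
    · simp only [hi, iff_false]
      exact (ha i hJ).compl
  have hEm' : ∀ A, MeasurableSet (E A) := fun A => ℱ.le 0 _ (hEm A)
  have harms : ∀ A ω, ω ∈ E A → armsIn (fun i => a i ω) k = A := fun A ω hω => by
    ext i
    rw [mem_armsIn]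
    exact hω i
  have hbound : ∀ A, μ.real (E A ∩ Bad) ≤
      Real.exp (-θ) * Real.exp (s ^ 2 / 8) ^ n * μ.real (E A) := fun A => by
    have h1 : ∫ ω in E A, samplingProcess A n T (fun s => φ s ω) (v ω) ∂μ =
        ∫ ω in E A, avgProd (v ω) n A ∂μ := by
      refine integral_samplingProcess ℱ n
        (fun t ω => remaining (fun j => a j ω) (fun s => φ s ω) t (sel t ω)) (one_le_exp_bound s q)
        (fun ω i => expWeight_mem _ i) (hEm A) hvm (fun t ht => (hstep t ht).2.1) ?_
        (fun t ht i => (hstep t ht).2.2.2 i)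
      intro t ht
      filter_upwards [(hstep t ht).2.2.1] with ω hω hωE
      refine ⟨hω.1.2, ?_⟩
      rw [remaining_eq_unpulled]
      -- The draw is either from what is left of A or from another cell, hence disjoint from A.
      by_cases hsel : sel t ω = k
      · left
        rw [hsel, harms A ω hωE]
      · right
        rw [← harms A ω hωE, Finset.disjoint_left]
        intro i hi hi'
        exact hsel (eq_of_mem_cell (mem_armsIn.1 (Finset.mem_filter.1 hi).1) (mem_armsIn.1 hi'))
    have h2 : ∫ ω in E A, avgProd (v ω) n A ∂μ ≤ μ.real (E A) * Real.exp (s ^ 2 / 8) ^ n := by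
      have := integral_avgProd_le hE hm hm01 hJ hq0 hq1 hq s n (Finset.empty_subset A)
        (Finset.Subset.refl A) (Finset.disjoint_empty_left A)
      have hind : ∀ ω, ∏ i, fits J A i (a i ω) = (E A).indicator (fun _ => 1) ω := fun ω =>
        prod_fits J A fun i => a i ω
      simp_rw [hind] at this
      rw [integral_indicator_const _ (hEm' A)] at this
      simp only [Finset.prod_empty, one_mul, Finset.card_empty, zero_add, smul_eq_mul,
        mul_one] at this
      rw [← integral_indicator (hEm' A)]
      refine le_of_eq_of_le (integral_congr_ae (.of_forall fun ω => ?_)) this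
      by_cases hω : ω ∈ E A <;> simp [hω, v]
    have hZm : ∀ ω, samplingProcess A n T (fun s => φ s ω) (v ω) ∈ Set.Icc 0 _ := fun ω =>
      samplingProcess_mem (one_le_exp_bound s q) fun i => expWeight_mem _ i
    have hZmeas : Measurable fun ω => samplingProcess A n T (fun s => φ s ω) (v ω) :=
      measurable_of_history (samplingProcess A n T) (fun h => measurable_samplingProcess A n T h)
        (fun h h' w hh => samplingProcess_congr hh)
        (fun t ht => (hstep t ht).2.1.mono (ℱ.le _) le_rfl) (hvm.mono (ℱ.le 0) le_rfl)
    have h3 := mul_meas_ge_le_integral_of_nonneg (μ := μ.restrict (E A))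
      (f := fun ω => samplingProcess A n T (fun s => φ s ω) (v ω))
      (.of_forall fun ω => (hZm ω).1)
      (Integrable.of_mem_Icc 0 _ hZmeas.aemeasurable (.of_forall hZm)) (Real.exp θ)
    have h4 : μ.real (E A ∩ Bad) ≤ (μ.restrict (E A)).real
        {ω | Real.exp θ ≤ samplingProcess A n T (fun s => φ s ω) (v ω)} := by
      rw [measureReal_restrict_apply (measurableSet_le measurable_const hZmeas)]
      refine measureReal_mono ?_
      rintro ω ⟨hωE, t, htT, hc, hθ⟩
      refine ⟨?_, hωE⟩
      rw [Set.mem_ofPred_eq]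
      rw [card_pulls, harms A ω hωE] at hc
      rw [samplingProcess_of_pullCount_eq hc htT]
      simp only [v, expWeight]
      rw [← Real.exp_sum, Real.exp_le_exp]
      refine hθ.trans_eq (Finset.sum_congr ?_ fun _ _ => rfl)
      ext r
      simp only [pulls, Finset.mem_filter]
      rw [← hJdef, hωE]
    calc μ.real (E A ∩ Bad) ≤ Real.exp (-θ) * (Real.exp θ * (μ.restrict (E A)).real
          {ω | Real.exp θ ≤ samplingProcess A n T (fun s => φ s ω) (v ω)}) := by
          rw [← mul_assoc, ← Real.exp_add, neg_add_cancel, Real.exp_zero, one_mul]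
          exact h4
      _ ≤ Real.exp (-θ) * (μ.real (E A) * Real.exp (s ^ 2 / 8) ^ n) := by
          exact mul_le_mul_of_nonneg_left (h3.trans (h1.trans_le h2)) (Real.exp_pos _).le
      _ = _ := by ring
  have hcover : Bad ⊆ ⋃ A ∈ (Finset.univ : Finset (Finset (Fin N))), E A ∩ Bad := fun ω hω => by
    simp only [Finset.mem_univ, Set.iUnion_true, Set.mem_iUnion]
    exact ⟨armsIn (fun i => a i ω) k, fun i => (mem_armsIn (x := fun i => a i ω)).symm, hω⟩
  have hdisj : ∑ A, μ.real (E A) ≤ 1 := by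
    rw [← measureReal_biUnion_finset (fun A _ B _ hAB => ?_) fun A _ => hEm' A]
    · exact measureReal_le_one
    · refine Set.disjoint_left.2 fun ω hA hB => hAB ?_
      rw [← harms A ω hA, ← harms B ω hB]
  calc μ.real Bad ≤ ∑ A, μ.real (E A ∩ Bad) :=
        (measureReal_mono hcover (measure_ne_top _ _)).trans (measureReal_biUnion_finset_le _ _)
    _ ≤ ∑ A, Real.exp (-θ) * Real.exp (s ^ 2 / 8) ^ n * μ.real (E A) :=
        Finset.sum_le_sum fun A _ => hbound A
    _ ≤ Real.exp (-θ) * Real.exp (s ^ 2 / 8) ^ n * 1 := by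
        rw [← Finset.mul_sum]
        gcongr
    _ = _ := mul_one _

/-- Hoeffding bound for the average reward of the first `n` arms pulled in a cell. -/
theorem measure_empMean_deviation_le (hE : IsEnvironment μ m a y) (hm : Measurable m)
    (hm01 : ∀ x, m x ∈ Set.Icc (0 : ℝ) 1) (hA : IsUCBF μ a y T K δ φ) (k : Fin K) {n : ℕ}
    (hn : 0 < n) {w : ℝ} (hw : 0 ≤ w) :
    μ.real {ω | (∀ i, y i ω ∈ Set.Icc (0 : ℝ) 1) ∧
      ∃ t ≤ T, (pulls (fun i => a i ω) (fun s => φ s ω) t k).card = n ∧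
      w < |empMean (fun i => a i ω) (fun i => y i ω) (fun s => φ s ω) t k - cellMean m k|} ≤
      2 * Real.exp (-(2 * n * w ^ 2)) := by
  have hn' : (0 : ℝ) < n := by exact_mod_cast hn
  have key : ∀ s : ℝ, s ^ 2 = (4 * w) ^ 2 →
      Real.exp (-(4 * w * (n * w))) * Real.exp (s ^ 2 / 8) ^ n = Real.exp (-(2 * n * w ^ 2)) := by
    intro s hs
    rw [hs, ← Real.exp_nat_mul, ← Real.exp_add]
    congr 1
    ring
  -- The value s = 4w minimizes -snw + ns²/8, with minimum -2nw².
  have h1 := measure_sum_pulls_ge_le hE hm hm01 hA k n (4 * w) (4 * w * (n * w))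
  have h2 := measure_sum_pulls_ge_le hE hm hm01 hA k n (-(4 * w)) (4 * w * (n * w))
  rw [key _ rfl] at h1
  rw [key _ (neg_sq _)] at h2
  rw [two_mul]
  refine le_trans (measureReal_mono ?_) ((measureReal_union_le _ _).trans (add_le_add h1 h2))
  rintro ω ⟨hy, t, htT, hc, hdev⟩
  have hsum : ∑ r ∈ pulls (fun i => a i ω) (fun s => φ s ω) t k,
      (clip (y (φ r ω) ω) - cellMean m k) =
      n * (empMean (fun i => a i ω) (fun i => y i ω) (fun s => φ s ω) t k - cellMean m k) := by
    rw [Finset.sum_sub_distrib, Finset.sum_const, nsmul_eq_mul, hc, mul_sub, empMean, hc,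
      mul_div_cancel₀ _ hn'.ne']
    congr 1
    exact Finset.sum_congr rfl fun r _ => clip_of_mem (hy _)
  rcases lt_abs.1 hdev with h | h
  · left
    refine ⟨t, htT, hc, ?_⟩
    rw [← Finset.mul_sum, hsum]
    gcongr
  · right
    refine ⟨t, htT, hc, ?_⟩
    rw [← Finset.mul_sum, hsum]
    have : n * w ≤ n * -(empMean (fun i => a i ω) (fun i => y i ω) (fun s => φ s ω) t k
      - cellMean m k) := by gcongr
    nlinarith [mul_le_mul_of_nonneg_left this hw]

open Classical in
/-- Hoeffding bound for the number of arms with covariate in a given set. -/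
theorem measure_card_deviation_le (hE : IsEnvironment μ m a y) {J : Set I} (hJ : MeasurableSet J)
    {u : ℝ} (hu : 0 ≤ u) :
    μ.real {ω | u ≤ |(({i | a i ω ∈ J} : Finset (Fin N)).card : ℝ) -
      N * (volume : Measure I).real J|} ≤ 2 * Real.exp (-(2 * u ^ 2 / N)) := by
  let X : Fin N → Ω → ℝ := fun i ω => J.indicator 1 (a i ω)
  have hind : Measurable (J.indicator (1 : I → ℝ)) := measurable_one.indicator hJ
  have hXm : ∀ i, Measurable (X i) := fun i => hind.comp (hE.measurable_covariate i)
  have hXb : ∀ i ω, X i ω ∈ Set.Icc (0 : ℝ) 1 := fun i ω => by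
    by_cases h : a i ω ∈ J <;> simp [X, h]
  have hXe : ∀ i, μ[X i] = (volume : Measure I).real J := fun i => by
    rw [← integral_indicator_one hJ, ← hE.uniform i,
      integral_map (hE.measurable_covariate i).aemeasurable hind.aestronglyMeasurable]
  have hsub : ∀ i, HasSubgaussianMGF (fun ω => X i ω - (volume : Measure I).real J)
      ((‖(1 : ℝ) - 0‖₊ / 2) ^ 2) μ := fun i => by
    rw [← hXe i]
    exact hasSubgaussianMGF_of_mem_Icc (hXm i).aemeasurable (.of_forall (hXb i))
  have hindep : iIndepFun (fun i ω => X i ω - (volume : Measure I).real J) μ :=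
    hE.indep.comp (fun _ x => J.indicator 1 x - (volume : Measure I).real J)
      fun _ => hind.sub_const _
  have hindep' : iIndepFun (fun i ω => -(X i ω - (volume : Measure I).real J)) μ :=
    hindep.comp (fun _ x => -x) fun _ => measurable_neg
  have h1 := HasSubgaussianMGF.measure_sum_ge_le_of_iIndepFun hindep (s := Finset.univ)
    (fun i _ => hsub i) hu
  have h2 := HasSubgaussianMGF.measure_sum_ge_le_of_iIndepFun hindep' (s := Finset.univ)
    (fun i _ => (hsub i).neg) hu
  have hsum : ∀ ω, ∑ i, (X i ω - (volume : Measure I).real J) =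
      (({i | a i ω ∈ J} : Finset (Fin N)).card : ℝ) - N * (volume : Measure I).real J := fun ω => by
    rw [Finset.sum_sub_distrib]
    simp [X, Set.indicator_apply]
  have hexp : Real.exp (-u ^ 2 / (2 * ((∑ _i : Fin N, (‖(1 : ℝ) - 0‖₊ / 2) ^ 2 : NNReal) : ℝ))) =
      Real.exp (-(2 * u ^ 2 / N)) := by
    congr 1
    simp
    ring
  push_cast at h1 h2 hexp
  rw [hexp] at h1 h2
  rw [two_mul]
  refine le_trans (measureReal_mono ?_) ((measureReal_union_le _ _).trans (add_le_add h1 h2))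
  intro ω hω
  rcases le_abs.1 (Set.mem_ofPred_eq ▸ hω) with h | h
  · left
    rw [Set.mem_ofPred_eq, hsum]
    exact h
  · right
    rw [Set.mem_ofPred_eq, Finset.sum_neg_distrib, hsum]
    exact h

open Classical in
/-- Almost surely, the arm pulled at a given round is available in the selected cell. -/
theorem ae_mem_remaining {ℱ : Filtration ℕ mΩ} {t : ℕ} {ψ : Ω → Fin N} (hψ : Measurable ψ)
    {R : Ω → Finset (Fin N)}
    (hcond : ∀ i, μ[Set.indicator {ω | ψ ω = i} (fun _ => (1 : ℝ)) | ℱ t] =ᵐ[μ]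
      fun ω => if i ∈ R ω then ((R ω).card : ℝ)⁻¹ else 0) :
    ∀ᵐ ω ∂μ, ψ ω ∈ R ω := by
  have hψm : ∀ i, MeasurableSet {ω | ψ ω = i} := fun i => hψ (measurableSet_singleton i)
  have key : ∀ i, ∀ᵐ ω ∂μ, ψ ω = i → i ∈ R ω := fun i => by
    set c := μ[Set.indicator {ω | ψ ω = i} (fun _ => (1 : ℝ)) | ℱ t] with hc
    have hcm : Measurable[ℱ t] c := stronglyMeasurable_condExp.measurable
    have hS : MeasurableSet[ℱ t] {ω | c ω = 0} := hcm (measurableSet_singleton 0)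
    have hi : Integrable (Set.indicator {ω | ψ ω = i} (fun _ => (1 : ℝ))) μ :=
      (integrable_const 1).indicator (hψm i)
    -- On the event that the conditional probability of drawing i vanishes, its integral is the
    -- probability of drawing i there; hence this joint event is null.
    have h1 := setIntegral_condExp (ℱ.le t) hi hS
    have h2 : ∫ ω in {ω | c ω = 0}, c ω ∂μ = 0 := by
      rw [setIntegral_congr_fun (g := fun _ => 0) (ℱ.le t _ hS) fun ω hω => hω]
      simp
    rw [← hc, h2, setIntegral_indicator (hψm i), setIntegral_const, smul_eq_mul, mul_one] at h1
    have h3 : ∀ᵐ ω ∂μ, ω ∉ {ω | c ω = 0} ∩ {ω | ψ ω = i} := by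
      rw [← measure_eq_zero_iff_ae_notMem]
      exact (measureReal_eq_zero_iff).1 h1.symm
    filter_upwards [h3, hcond i] with ω h4 h5 h6
    by_contra h7
    rw [if_neg h7] at h5
    exact h4 ⟨h5, h6⟩
  filter_upwards [ae_all_iff.2 key] with ω hω
  exact hω _ rfl

end Deviation

/-! ### The threshold and the margin condition -/

section Threshold

variable {m : I → ℝ} {p Q : ℝ}

theorem zero_mem_lowerBounds_levels (hm01 : ∀ x, m x ∈ Set.Icc (0 : ℝ) 1) (hp1 : p ≤ 1) :
    0 ∈ lowerBounds {A : ℝ | (volume : Measure I).real {x | A ≤ m x} < p} := by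
  intro A hA
  by_contra hneg
  have : {x | A ≤ m x} = Set.univ := Set.eq_univ_of_forall fun x =>
    (not_le.1 hneg).le.trans (hm01 x).1
  rw [Set.mem_ofPred_eq, this, probReal_univ] at hA
  linarith

theorem mem_levels_of_one_lt (hm01 : ∀ x, m x ∈ Set.Icc (0 : ℝ) 1) (hp0 : 0 < p) {A : ℝ}
    (hA : 1 < A) : A ∈ {A : ℝ | (volume : Measure I).real {x | A ≤ m x} < p} := by
  have : {x | A ≤ m x} = ∅ := Set.eq_empty_of_forall_notMem fun x (hx : A ≤ m x) =>
    absurd (hA.trans_le hx) (not_lt.2 (hm01 x).2)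
  rwa [Set.mem_ofPred_eq, this, measureReal_empty]

theorem threshold_mem (hm01 : ∀ x, m x ∈ Set.Icc (0 : ℝ) 1) (hp0 : 0 < p) (hp1 : p ≤ 1) :
    threshold m p ∈ Set.Icc (0 : ℝ) 1 := by
  refine ⟨le_csInf ⟨2, mem_levels_of_one_lt hm01 hp0 one_lt_two⟩ (zero_mem_lowerBounds_levels hm01 hp1), ?_⟩
  refine le_of_forall_gt_imp_ge_of_dense fun A hA => ?_
  exact csInf_le ⟨0, zero_mem_lowerBounds_levels hm01 hp1⟩ (mem_levels_of_one_lt hm01 hp0 hA)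

/-- Under the margin condition, the superlevel set of the threshold has measure exactly `p`. -/
theorem volume_threshold_eq (hm01 : ∀ x, m x ∈ Set.Icc (0 : ℝ) 1) (hp0 : 0 < p) (hp1 : p ≤ 1)
    (hQ : 0 < Q) (hmar : Margin m (threshold m p) Q) :
    (volume : Measure I).real {x | threshold m p ≤ m x} = p := by
  set M := threshold m p
  have hne := (⟨2, mem_levels_of_one_lt hm01 hp0 one_lt_two⟩ :
    {A : ℝ | (volume : Measure I).real {x | A ≤ m x} < p}.Nonempty)
  have hb : BddBelow {A : ℝ | (volume : Measure I).real {x | A ≤ m x} < p} :=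
    ⟨0, zero_mem_lowerBounds_levels hm01 hp1⟩
  -- The margin condition makes thin strips around M negligible, so the levels just above and just
  -- below M determine the measure at M itself.
  have hsmall : ∀ e : ℝ, 0 < e → ∃ ε, 0 < ε ∧ (volume : Measure I).real {x | |M - m x| ≤ ε} ≤ e :=
    fun e he => by
      refine ⟨min (1 / 2) (e / Q), by positivity, (hmar _ (by positivity) ?_).trans ?_⟩
      · exact (min_le_left _ _).trans_lt (by norm_num)
      · calc Q * min (1 / 2) (e / Q) ≤ Q * (e / Q) := by gcongr; exact min_le_right _ _
          _ = e := by field_simp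
  apply le_antisymm
  · refine le_of_forall_pos_le_add fun e he => ?_
    obtain ⟨ε, hε, h⟩ := hsmall e he
    obtain ⟨A, hA, hAM⟩ := exists_lt_of_csInf_lt hne (lt_add_of_pos_right M hε)
    have hA' : (volume : Measure I).real {x | A ≤ m x} < p := hA
    have hsub : {x | M ≤ m x} ⊆ {x | A ≤ m x} ∪ {x | |M - m x| ≤ ε} := fun x hx => by
      by_cases hx' : A ≤ m x
      · exact Or.inl hx'
      · right
        have hx : M ≤ m x := hx
        rw [Set.mem_ofPred_eq, abs_le]
        push Not at hx'
        constructor <;> linarith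
    have := (measureReal_mono (μ := (volume : Measure I)) hsub).trans (measureReal_union_le _ _)
    linarith
  · refine le_of_forall_pos_le_add fun e he => ?_
    obtain ⟨ε, hε, h⟩ := hsmall e he
    have hA : ¬ (volume : Measure I).real {x | M - ε ≤ m x} < p := fun hlt => by
      have : M ≤ M - ε := csInf_le hb hlt
      linarith
    have hsub : {x | M - ε ≤ m x} ⊆ {x | M ≤ m x} ∪ {x | |M - m x| ≤ ε} := fun x hx => by
      by_cases hx' : M ≤ m x
      · exact Or.inl hx'
      · right
        have hx : M - ε ≤ m x := hx
        rw [Set.mem_ofPred_eq, abs_le]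
        push Not at hx'
        constructor <;> linarith
    have := (measureReal_mono (μ := (volume : Measure I)) hsub).trans (measureReal_union_le _ _)
    linarith

/-- For ε ≥ 1 the bound is trivial, as a probability is at most 1; the maximum with 1 removes the
restriction on ε. -/
theorem Margin.le_max {M : ℝ} (h : Margin m M Q) {ε : ℝ} (hε : 0 < ε) :
    (volume : Measure I).real {x | |M - m x| ≤ ε} ≤ max Q 1 * ε := by
  by_cases h1 : ε < 1
  · exact (h ε hε h1).trans (by gcongr; exact le_max_left _ _)
  · refine measureReal_le_one.trans ?_
    push Not at h1
    nlinarith [le_max_right Q 1]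

end Threshold

/-! ### Consequences of the weak Lipschitz condition -/

/-- If some point is at distance more than `r` of `B`, then the points outside `B` at distance at
most `r` of `B` have measure at least `r`. -/
theorem le_volume_strip {B : Set I} (hB : B.Nonempty) {x : I} {r : ℝ} (hr : 0 ≤ r)
    (hx : r < Metric.infDist x B) :
    r ≤ (volume : Measure I).real {w | w ∉ B ∧ Metric.infDist w B ≤ r} := by
  -- Here z is a point of the closure of B nearest to x. Points strictly between z and x are closer
  -- to x than z is, so they avoid B; those within r of z fill an interval of length r.
  obtain ⟨z, hz, hxz⟩ := isClosed_closure.isCompact.exists_infDist_eq_dist hB.closure x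
  rw [Metric.infDist_closure] at hxz
  have hdist : ∀ u v : I, dist u v = |(u : ℝ) - v| := fun u v => by
    rw [Subtype.dist_eq, Real.dist_eq]
  have hmem : ∀ w : I, dist w z ≤ r → dist x w < dist x z →
      w ∈ {w | w ∉ B ∧ Metric.infDist w B ≤ r} := fun w h1 h2 => by
    refine ⟨fun hwB => ?_, ?_⟩
    · have := Metric.infDist_le_dist_of_mem (x := x) hwB
      linarith
    · rw [← Metric.infDist_closure]
      exact (Metric.infDist_le_dist_of_mem hz).trans h1
  rw [hxz] at hx
  rcases lt_or_ge (z : ℝ) x with hlt | hge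
  · have h1 : dist x z = x - z := by rw [hdist, abs_of_pos (by linarith)]
    have hzr : (z : ℝ) + r ∈ I := ⟨add_nonneg z.2.1 hr, by linarith [x.2.2]⟩
    calc r = (volume : Measure I).real (Set.Ioo z ⟨z + r, hzr⟩) := by
          rw [measureReal_def, unitInterval.volume_Ioo, ENNReal.toReal_ofReal] <;> simp [hr]
      _ ≤ _ := by
          refine measureReal_mono fun w hw => ?_
          have hw1 : (z : ℝ) < w := hw.1
          have hw2 : (w : ℝ) < z + r := hw.2
          refine hmem w ?_ ?_
          · rw [hdist, abs_of_pos (by linarith)]; linarith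
          · rw [h1, hdist, abs_of_pos (by linarith)]; linarith
  · have h1 : dist x z = z - x := by rw [hdist, abs_sub_comm, abs_of_nonneg (by linarith)]
    have hzr : (z : ℝ) - r ∈ I := ⟨by linarith [x.2.1], by linarith [z.2.2]⟩
    calc r = (volume : Measure I).real (Set.Ioo ⟨z - r, hzr⟩ z) := by
          rw [measureReal_def, unitInterval.volume_Ioo, ENNReal.toReal_ofReal] <;> simp [hr]
      _ ≤ _ := by
          refine measureReal_mono fun w hw => ?_
          have hw1 : (w : ℝ) < z := hw.2
          have hw2 : (z : ℝ) - r < w := hw.1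
          refine hmem w ?_ ?_
          · rw [hdist, abs_of_neg (by linarith)]; linarith
          · rw [h1, hdist, abs_of_neg (by linarith)]; linarith

section WeakLipschitz

variable {m : I → ℝ} {M L : ℝ} (hL : 0 < L) (hlip : WeakLipschitz m M L)
include hL hlip

/-- Between w above M and y below M, the increment exceeds m w - M. The first term of the weak
Lipschitz maximum is thus too small and the Lipschitz term must dominate. -/
theorem sub_le_mul_infDist_lt {w : I} (hB : {x | m x < M}.Nonempty) (hw : M ≤ m w) :
    m w - M ≤ L * Metric.infDist w {x | m x < M} := by
  rw [← div_le_iff₀' hL, Metric.le_infDist hB]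
  intro y hy
  have hy : m y < M := hy
  rw [div_le_iff₀' hL, Subtype.dist_eq, Real.dist_eq]
  have h := hlip w y
  rw [abs_of_pos (by linarith : 0 < m w - m y), abs_of_nonpos (by linarith : M - m w ≤ 0)] at h
  rcases le_max_iff.1 h with h | h <;> linarith

theorem sub_le_mul_infDist_le {w : I} (hB : {x | M ≤ m x}.Nonempty) (hw : m w < M) :
    M - m w ≤ L * Metric.infDist w {x | M ≤ m x} := by
  rw [← div_le_iff₀' hL, Metric.le_infDist hB]
  intro y hy
  have hy : M ≤ m y := hy
  rw [div_le_iff₀' hL, Subtype.dist_eq, Real.dist_eq, abs_sub_comm]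
  have h := hlip y w
  rw [abs_of_pos (by linarith : 0 < m y - m w), abs_of_nonpos (by linarith : M - m y ≤ 0)] at h
  rcases le_max_iff.1 h with h | h <;> linarith

/-- To climb from below M to above M + η, the function must spend length η/L in between: points
within η/L of the sublevel set are at height at most η. This is a lower bound on level strips,
opposite to the margin condition. -/
theorem le_volume_strip_above (hB : {x | m x < M}.Nonempty) {x : I} {η : ℝ} (hη : 0 ≤ η)
    (hx : M + η < m x) :
    η / L ≤ (volume : Measure I).real {w | M ≤ m w ∧ m w ≤ M + η} := by
  refine (le_volume_strip hB (x := x) (by positivity) ?_).trans (measureReal_mono fun w hw => ?_)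
  · rw [div_lt_iff₀' hL]
    linarith [sub_le_mul_infDist_lt hL hlip hB (w := x) (by linarith)]
  · have h1 : M ≤ m w := not_lt.1 hw.1
    refine ⟨h1, ?_⟩
    have h2 := sub_le_mul_infDist_lt hL hlip hB h1
    have h3 := mul_le_mul_of_nonneg_left hw.2 hL.le
    rw [mul_div_cancel₀ _ hL.ne'] at h3
    linarith

theorem le_volume_strip_below (hB : {x | M ≤ m x}.Nonempty) {x : I} {η : ℝ} (hη : 0 ≤ η)
    (hx : m x < M - η) :
    η / L ≤ (volume : Measure I).real {w | M - η ≤ m w ∧ m w < M} := by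
  refine (le_volume_strip hB (x := x) (by positivity) ?_).trans (measureReal_mono fun w hw => ?_)
  · rw [div_lt_iff₀' hL]
    linarith [sub_le_mul_infDist_le hL hlip hB (w := x) (by linarith)]
  · have h1 : m w < M := not_le.1 hw.1
    refine ⟨?_, h1⟩
    have h2 := sub_le_mul_infDist_le hL hlip hB h1
    have h3 := mul_le_mul_of_nonneg_left hw.2 hL.le
    rw [mul_div_cancel₀ _ hL.ne'] at h3
    linarith

variable {K : ℕ} {k : Fin K}

theorem abs_sub_le_max_of_mem_cell {x y : I} (hx : x ∈ cell K k) (hy : y ∈ cell K k) :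
    |m x - m y| ≤ max |m x - M| (L / K) := by
  refine (hlip x y).trans ?_
  rw [abs_sub_comm M]
  refine max_le_max le_rfl ?_
  rw [div_eq_mul_one_div]
  gcongr
  exact abs_sub_le_of_mem_cell hx hy

theorem abs_sub_le_two_mul_of_mem_cell {x y : I} (hx : x ∈ cell K k) (hy : y ∈ cell K k) {u : ℝ}
    (hu : L / K ≤ u) (h : |m x - M| ≤ u) : |m y - M| ≤ 2 * u := by
  have h1 := (abs_sub_le_max_of_mem_cell hL hlip hx hy).trans (max_le h hu)
  rw [abs_le] at *
  constructor <;> linarith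

variable (hm : Measurable m) (hm01 : ∀ x, m x ∈ Set.Icc (0 : ℝ) 1)
include hm hm01

theorem abs_cellMean_sub_le {x : I} (hx : x ∈ cell K k) {u : ℝ} (hu : L / K ≤ u)
    (h : |m x - M| ≤ u) : |cellMean m k - M| ≤ 2 * u := by
  have key := fun y hy => abs_le.1 (abs_sub_le_two_mul_of_mem_cell hL hlip hx (y := y) hy hu h)
  have h1 := cellMean_le (k := k) (c := M + 2 * u) hm hm01 fun y hy => by linarith [(key y hy).2]
  have h2 := le_cellMean (k := k) (c := M - 2 * u) hm hm01 fun y hy => by linarith [(key y hy).1]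
  rw [abs_le]
  constructor <;> linarith

/-- If one value were farther than 2u from M, the weak Lipschitz condition would keep every value of
the cell beyond the midpoint between it and M, and the mean would be farther than u. -/
theorem abs_sub_le_of_abs_cellMean_sub_le {y : I} (hy : y ∈ cell K k) {u : ℝ} (hu : L / K ≤ u)
    (h : |cellMean m k - M| ≤ u) : |m y - M| ≤ 2 * u := by
  by_contra hlt
  push Not at hlt
  have hu0 : 0 ≤ u := le_trans (by positivity) hu
  have habs := abs_le.1 h
  rcases lt_abs.1 hlt with hpos | hneg
  · have : (m y + M) / 2 ≤ cellMean m k := le_cellMean hm hm01 fun x hx => by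
      have h1 := abs_sub_le_max_of_mem_cell hL hlip hy hx
      have h2 := abs_sub_le_max_of_mem_cell hL hlip hx hy
      rcases le_max_iff.1 h2 with h2 | h2
      · rcases le_total M (m x) with h3 | h3
        · rw [abs_of_nonneg (by linarith : 0 ≤ m x - M)] at h2
          linarith [(abs_le.1 h2).1]
        · rw [abs_of_nonpos (by linarith : m x - M ≤ 0)] at h2
          linarith [(abs_le.1 h2).1]
      · linarith [(abs_le.1 h2).1]
    linarith
  · have : cellMean m k ≤ (m y + M) / 2 := cellMean_le hm hm01 fun x hx => by
      have h2 := abs_sub_le_max_of_mem_cell hL hlip hx hy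
      rcases le_max_iff.1 h2 with h2 | h2
      · rcases le_total M (m x) with h3 | h3
        · rw [abs_of_nonneg (by linarith : 0 ≤ m x - M)] at h2
          linarith [(abs_le.1 h2).2]
        · rw [abs_of_nonpos (by linarith : m x - M ≤ 0)] at h2
          linarith [(abs_le.1 h2).2]
      · linarith [(abs_le.1 h2).2]
    linarith

/-- From a point at or below M, the weak Lipschitz condition reaches height at most M + L/K within
the cell. -/
theorem lt_of_lt_cellMean {y : I} (hy : y ∈ cell K k) (h : M + L / K < cellMean m k) :
    M < m y := by
  by_contra hle
  push Not at hle
  have : cellMean m k ≤ M + L / K := cellMean_le hm hm01 fun x hx => by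
    have h1 := abs_sub_le_max_of_mem_cell hL hlip hy hx
    rw [abs_of_nonpos (by linarith : m y - M ≤ 0)] at h1
    have : 0 ≤ L / K := by positivity
    rcases le_max_iff.1 h1 with h2 | h2 <;> linarith [(abs_le.1 h2).1]
  linarith

theorem lt_of_cellMean_lt {y : I} (hy : y ∈ cell K k) (h : cellMean m k < M - L / K) :
    m y < M := by
  by_contra hle
  push Not at hle
  have : M - L / K ≤ cellMean m k := le_cellMean hm hm01 fun x hx => by
    have h1 := abs_sub_le_max_of_mem_cell hL hlip hy hx
    rw [abs_of_nonneg (by linarith : 0 ≤ m y - M)] at h1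
    have : 0 ≤ L / K := by positivity
    rcases le_max_iff.1 h1 with h2 | h2 <;> linarith [(abs_le.1 h2).2]
  linarith

end WeakLipschitz

/-! ### Counting cells -/

/-- Union of a family of cells. -/
def cells (K : ℕ) (S : Finset (Fin K)) : Set I := ⋃ k ∈ S, cell K k

theorem mem_cells {K : ℕ} {S : Finset (Fin K)} {x : I} : x ∈ cells K S ↔ ∃ k ∈ S, x ∈ cell K k := by
  simp [cells]

theorem measurableSet_cells (K : ℕ) (S : Finset (Fin K)) : MeasurableSet (cells K S) :=
  S.measurableSet_biUnion fun k _ => measurableSet_cell K k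

theorem volume_cells {K : ℕ} (S : Finset (Fin K)) :
    (volume : Measure I).real (cells K S) = S.card / K := by
  unfold cells
  rw [measureReal_biUnion_finset (fun k _ l _ hkl => ?_) fun k _ => measurableSet_cell K k]
  · simp only [volume_cell, Finset.sum_const, nsmul_eq_mul]
    ring
  · exact Set.disjoint_left.2 fun x hk hl => hkl (eq_of_mem_cell hk hl)

-- These cells are disjoint, have measure 1/K each, and lie in the strip of half-width 2u around M,
-- whose measure the margin condition bounds.
open Classical in
theorem card_cells_near_le {m : I → ℝ} {M L Q : ℝ} (hL : 0 < L) (hlip : WeakLipschitz m M L)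
    (hm : Measurable m) (hm01 : ∀ x, m x ∈ Set.Icc (0 : ℝ) 1) (hmar : Margin m M Q) {K : ℕ}
    (hK : 0 < K) {u : ℝ} (hu : L / K ≤ u) :
    (({k | |cellMean m k - M| ≤ u} : Finset (Fin K)).card : ℝ) ≤ 2 * max Q 1 * K * u := by
  have hK' : (0 : ℝ) < K := by exact_mod_cast hK
  have hu0 : 0 < u := lt_of_lt_of_le (by positivity) hu
  have h1 := volume_cells ({k | |cellMean m k - M| ≤ u} : Finset (Fin K))
  have h2 : (volume : Measure I).real (cells K {k | |cellMean m k - M| ≤ u}) ≤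
      max Q 1 * (2 * u) := by
    refine (measureReal_mono fun x hx => ?_).trans (hmar.le_max (by positivity))
    obtain ⟨k, hk, hx⟩ := mem_cells.1 hx
    rw [Set.mem_ofPred_eq, abs_sub_comm]
    exact abs_sub_le_of_abs_cellMean_sub_le hL hlip hm hm01 hx hu (by simpa using hk)
  rw [h1, div_le_iff₀ hK'] at h2
  linarith

/-! ### Dyadic summation -/

-- Each index is charged to the dyadic scale just below d l, where f is larger; the linear growth of
-- the counts bounds the number of indices charged to each scale.
open Classical in
theorem sum_le_sum_dyadic {ι : Type*} (S : Finset ι) (d : ι → ℝ) {d₀ c : ℝ} (hd₀ : 0 < d₀)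
    {f : ℝ → ℝ} (hf0 : ∀ u, d₀ ≤ u → 0 ≤ f u) (hf : ∀ u v, d₀ ≤ u → u ≤ v → f v ≤ f u)
    (hd : ∀ l ∈ S, d₀ ≤ d l) {J : ℕ} (hJ : ∀ l ∈ S, d l < 2 ^ J * d₀)
    (hc : ∀ u, d₀ ≤ u → (({l ∈ S | d l ≤ u}).card : ℝ) ≤ c * u) :
    ∑ l ∈ S, f (d l) ≤ ∑ j ∈ Finset.range J, f (2 ^ j * d₀) * (c * (2 ^ (j + 1) * d₀)) := by
  have hge : ∀ j : ℕ, d₀ ≤ 2 ^ j * d₀ := fun j =>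
    le_mul_of_one_le_left hd₀.le (one_le_pow₀ one_le_two)
  have hpt : ∀ l ∈ S, f (d l) ≤ ∑ j ∈ Finset.range J,
      if d l ≤ 2 ^ (j + 1) * d₀ then f (2 ^ j * d₀) else 0 := fun l hl => by
    have hex : ∃ j, d l < 2 ^ j * d₀ := ⟨J, hJ l hl⟩
    have hspec := Nat.find_spec hex
    have hpos : Nat.find hex ≠ 0 := fun h0 => by
      rw [h0, pow_zero, one_mul] at hspec
      linarith [hd l hl]
    obtain ⟨j, hj⟩ := Nat.exists_eq_succ_of_ne_zero hpos
    have hjlt : ¬ d l < 2 ^ j * d₀ := Nat.find_min hex (by omega)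
    have hjJ : j < J := by
      have := Nat.find_min' hex (hJ l hl)
      omega
    rw [hj] at hspec
    push Not at hjlt
    calc f (d l) ≤ f (2 ^ j * d₀) := hf _ _ (hge j) hjlt
      _ = if d l ≤ 2 ^ (j + 1) * d₀ then f (2 ^ j * d₀) else 0 := by rw [if_pos hspec.le]
      _ ≤ _ := Finset.single_le_sum (f := fun j => if d l ≤ 2 ^ (j + 1) * d₀ then
          f (2 ^ j * d₀) else 0) (fun i _ => by
            split_ifs
            · exact hf0 _ (hge i)
            · exact le_rfl) (Finset.mem_range.2 hjJ)
  refine (Finset.sum_le_sum hpt).trans ?_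
  rw [Finset.sum_comm]
  refine Finset.sum_le_sum fun j _ => ?_
  rw [← Finset.sum_filter, Finset.sum_const, nsmul_eq_mul, mul_comm]
  exact mul_le_mul_of_nonneg_left (hc _ (hge _)) (hf0 _ (hge j))

-- Every dyadic scale contributes the same amount 2c, whence the factor J.
open Classical in
theorem sum_inv_le_dyadic {ι : Type*} (S : Finset ι) (d : ι → ℝ) {d₀ c : ℝ} (hd₀ : 0 < d₀)
    (hd : ∀ l ∈ S, d₀ ≤ d l) {J : ℕ} (hJ : ∀ l ∈ S, d l < 2 ^ J * d₀)
    (hc : ∀ u, d₀ ≤ u → (({l ∈ S | d l ≤ u}).card : ℝ) ≤ c * u) :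
    ∑ l ∈ S, 1 / d l ≤ 2 * c * J := by
  refine (sum_le_sum_dyadic S d hd₀ (f := fun u => 1 / u) (fun u hu => ?_) (fun u v hu huv => ?_)
    hd hJ hc).trans_eq ?_
  · have := hd₀.trans_le hu
    positivity
  · exact one_div_le_one_div_of_le (hd₀.trans_le hu) huv
  · rw [Finset.sum_congr rfl fun j _ => show 1 / (2 ^ j * d₀) * (c * (2 ^ (j + 1) * d₀)) = 2 * c by
      rw [pow_succ]; field_simp]
    simp
    ring

-- The contributions of the scales decay geometrically, so the smallest scale dominates and no
-- logarithm appears.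
open Classical in
theorem sum_inv_sq_le_dyadic {ι : Type*} (S : Finset ι) (d : ι → ℝ) {d₀ c : ℝ} (hd₀ : 0 < d₀)
    (hd : ∀ l ∈ S, d₀ ≤ d l) (hc0 : 0 ≤ c)
    (hc : ∀ u, d₀ ≤ u → (({l ∈ S | d l ≤ u}).card : ℝ) ≤ c * u) :
    ∑ l ∈ S, 1 / d l ^ 2 ≤ 4 * c / d₀ := by
  obtain ⟨J, hJ⟩ : ∃ J : ℕ, ∀ l ∈ S, d l < 2 ^ J * d₀ := by
    obtain ⟨J, hJ⟩ := pow_unbounded_of_one_lt ((∑ l ∈ S, d l) / d₀) (one_lt_two (α := ℝ))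
    refine ⟨J, fun l hl => ?_⟩
    rw [div_lt_iff₀ hd₀] at hJ
    exact (Finset.single_le_sum (fun i hi => hd₀.le.trans (hd i hi)) hl).trans_lt hJ
  refine (sum_le_sum_dyadic S d hd₀ (f := fun u => 1 / u ^ 2) (fun u hu => by positivity)
    (fun u v hu huv => ?_) hd hJ hc).trans ?_
  · have := hd₀.trans_le hu
    exact one_div_le_one_div_of_le (by positivity) (by gcongr)
  · have hgeom : ∑ j ∈ Finset.range J, ((1 : ℝ) / 2) ^ j ≤ 2 := by
      rw [geom_sum_eq (by norm_num)]
      have : (0 : ℝ) ≤ (1 / 2) ^ J := by positivity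
      rw [div_le_iff_of_neg (by norm_num)]
      linarith
    calc ∑ j ∈ Finset.range J, 1 / (2 ^ j * d₀) ^ 2 * (c * (2 ^ (j + 1) * d₀))
        = ∑ j ∈ Finset.range J, 2 * c / d₀ * (1 / 2) ^ j := by
          refine Finset.sum_congr rfl fun j _ => ?_
          rw [one_div_pow]
          field_simp
          ring
      _ ≤ 2 * c / d₀ * 2 := by
          rw [← Finset.mul_sum]
          gcongr
      _ = 4 * c / d₀ := by ring

/-! ### Runs of UCBF on the concentration event -/

open Classical in
/-- The cells whose mean reward is at least `c`. -/
def topCells (m : I → ℝ) (K : ℕ) (c : ℝ) : Finset (Fin K) := {l | c ≤ cellMean m l}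

open Classical in
/-- The families of cells in which the number of arms has to be controlled. -/
def testFamilies (m : I → ℝ) (M L : ℝ) (K : ℕ) : Finset (Finset (Fin K)) :=
  (Finset.univ.image fun k : Fin K => {k}) ∪ (Finset.univ.image fun k : Fin K => topCells m K ((M + cellMean m k) / 2))
    ∪ {topCells m K (M - 4 * L / K)}

/-- The families are fixed by m, not by the data, so controlling all of them costs only a union
bound linear in K. -/
theorem card_testFamilies_le (m : I → ℝ) (M L : ℝ) (K : ℕ) :
    (testFamilies m M L K).card ≤ 2 * K + 1 := by
  classical
  unfold testFamilies
  refine (Finset.card_union_le _ _).trans ?_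
  rw [Finset.card_singleton]
  refine Nat.add_le_add_right ((Finset.card_union_le _ _).trans ?_) 1
  rw [two_mul]
  exact add_le_add (Finset.card_image_le.trans (by simp)) (Finset.card_image_le.trans (by simp))

open Classical in
/-- A run of UCBF along which the empirical means and the numbers of arms are close to their
expectations. -/
structure IsGoodRun {N K : ℕ} (m : I → ℝ) (M L : ℝ) (T : ℕ) (δ : ℝ) (x : Fin N → I)
    (r : Fin N → ℝ) (φ : ℕ → Fin N) (sel : ℕ → Fin K) : Prop where
  maySelect : ∀ t < T, MaySelect x r φ T δ t (sel t)
  mem_remaining : ∀ t < T, φ t ∈ remaining x φ t (sel t)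
  mean : ∀ k : Fin K, ∀ t ≤ T, (pulls x φ t k).Nonempty →
    |empMean x r φ t k - cellMean m k| ≤ √(Real.log (T / δ) / (2 * (pulls x φ t k).card))
  count : ∀ S ∈ testFamilies m M L K,
    |(({i | x i ∈ cells K S} : Finset (Fin N)).card : ℝ) - N * (volume : Measure I).real (cells K S)|
      ≤ N / (2 * K)

/-! ### Pull counts along a good run. -/

namespace IsGoodRun

variable {N K : ℕ} {m : I → ℝ} {M L : ℝ} {T : ℕ} {δ : ℝ} {x : Fin N → I}
    {r : Fin N → ℝ} {φ : ℕ → Fin N} {sel : ℕ → Fin K}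

theorem mem_cell_iff (h : IsGoodRun m M L T δ x r φ sel) {t : ℕ} (ht : t < T) {k : Fin K} :
    x (φ t) ∈ cell K k ↔ sel t = k := by
  have h1 : φ t ∈ armsIn x (sel t) := by
    have := h.mem_remaining t ht
    rw [remaining_eq_unpulled] at this
    exact (Finset.mem_filter.1 this).1
  rw [mem_armsIn] at h1
  exact ⟨fun h2 => eq_of_mem_cell h1 h2, fun h2 => h2 ▸ h1⟩

theorem injOn (h : IsGoodRun m M L T δ x r φ sel) : Set.InjOn φ (Finset.range T : Set ℕ) := by
  have key : ∀ s t, s < t → t < T → φ s ≠ φ t := fun s t hst ht => by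
    have := h.mem_remaining t ht
    rw [remaining_eq_unpulled] at this
    exact (Finset.mem_filter.1 this).2 s hst
  intro s hs t ht hst
  simp only [Finset.coe_range, Set.mem_Iio] at hs ht
  rcases lt_trichotomy s t with h1 | h1 | h1
  · exact absurd hst (key s t h1 ht)
  · exact h1
  · exact absurd hst.symm (key t s h1 hs)

theorem card_pulls_succ (h : IsGoodRun m M L T δ x r φ sel) {t : ℕ} (ht : t < T) (k : Fin K) :
    (pulls x φ (t + 1) k).card = (pulls x φ t k).card + if sel t = k then 1 else 0 := by
  rw [card_pulls, card_pulls, pullCount_succ]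
  simp only [mem_armsIn, h.mem_cell_iff ht]

theorem card_pulls_le_card_armsIn (h : IsGoodRun m M L T δ x r φ sel) (k : Fin K) :
    (pulls x φ T k).card ≤ (armsIn x k).card := by
  classical
  refine Finset.card_le_card_of_injOn φ (fun s hs => ?_) (h.injOn.mono ?_)
  · rw [Finset.mem_coe, mem_armsIn]
    exact (Finset.mem_filter.1 hs).2
  · exact Finset.coe_subset.2 (Finset.filter_subset _ _)

theorem sum_card_pulls (h : IsGoodRun m M L T δ x r φ sel) :
    ∑ k : Fin K, (pulls x φ T k).card = T := by
  classical
  have : ∀ k, pulls x φ T k = {s ∈ Finset.range T | sel s = k} := fun k =>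
    Finset.filter_congr fun s hs => h.mem_cell_iff (Finset.mem_range.1 hs)
  simp_rw [this]
  rw [← Finset.card_eq_sum_card_fiberwise fun _ _ => Finset.mem_coe.2 (Finset.mem_univ _),
    Finset.card_range]

open Classical in
theorem card_armsIn (h : IsGoodRun m M L T δ x r φ sel) (k : Fin K) :
    |((armsIn x k).card : ℝ) - N / K| ≤ N / (2 * K) := by
  have := h.count {k} (by simp [testFamilies])
  have e : ({i | x i ∈ cells K {k}} : Finset (Fin N)) = armsIn x k := by
    ext i
    simp [mem_cells, mem_armsIn]
  rw [volume_cells, Finset.card_singleton, e, Nat.cast_one, mul_one_div] at this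
  exact this

/-- Count concentration leaves at least N/(2K) ≥ 2 arms in every cell, so only exhaustion can kill a
cell. -/
theorem alive (h : IsGoodRun m M L T δ x r φ sel) (hN : (4 : ℝ) * K ≤ N) {k : Fin K} {i : Fin N}
    (hi : x i ∈ cell K k) {t : ℕ} (ht : ∀ s < t, φ s ≠ i) : Alive x φ t k := by
  refine ⟨?_, i, ?_⟩
  · have hK' : (0 : ℝ) < K := by exact_mod_cast (Nat.zero_le _).trans_lt k.2
    have h1 := (abs_le.1 (h.card_armsIn k)).1
    have h2 : (N : ℝ) / K = 2 * (N / (2 * K)) := by field_simp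
    have h3 : (2 : ℝ) ≤ N / (2 * K) := by
      rw [le_div_iff₀ (by positivity)]; linarith
    have : (2 : ℝ) ≤ (armsIn x k).card := by linarith
    exact_mod_cast this
  · rw [remaining_eq_unpulled]
    exact Finset.mem_filter.2 ⟨mem_armsIn.2 hi, ht⟩

/-- A cell which always has an alive competitor better by `D` is pulled at most
`1 + 2 log(T/δ) / D²` times. -/
theorem card_pulls_le (h : IsGoodRun m M L T δ x r φ sel) (hl : 0 ≤ Real.log (T / δ)) {k : Fin K}
    {D : ℝ} (hD : 0 < D)
    (hcomp : ∀ t < T, ∃ l : Fin K, Alive x φ t l ∧ cellMean m k + D ≤ cellMean m l) :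
    ((pulls x φ T k).card : ℝ) ≤ 1 + 2 * Real.log (T / δ) / D ^ 2 := by
  suffices H : ∀ t ≤ T, ((pulls x φ t k).card : ℝ) ≤ 1 + 2 * Real.log (T / δ) / D ^ 2 from
    H T le_rfl
  intro t
  induction t with
  | zero =>
    intro _
    have : pulls x φ 0 k = ∅ := by simp [pulls]
    rw [this]
    simp only [Finset.card_empty, Nat.cast_zero]
    positivity
  | succ t ih =>
    intro ht
    have ht' : t < T := ht
    rw [h.card_pulls_succ ht']
    split_ifs with hsel
    -- A first pull may belong to the initialisation; it accounts for the term 1.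
    · by_cases hemp : pulls x φ t k = ∅
      · rw [hemp]
        simp only [Finset.card_empty, zero_add, Nat.cast_one]
        have : 0 ≤ 2 * Real.log (T / δ) / D ^ 2 := by positivity
        linarith
      · obtain ⟨hal, h1, h2⟩ := h.maySelect t ht'
        rw [hsel] at hal h1 h2
        have hall : ∀ l : Fin K, Alive x φ t l → pulls x φ t l ≠ ∅ := fun l hl hl' =>
          hemp (h1 ⟨l, hl, hl'⟩)
        obtain ⟨l, hla, hlD⟩ := hcomp t ht'
        have hucb := h2 hall l hla
        have hml := (abs_le.1 (h.mean l t ht'.le (Finset.nonempty_iff_ne_empty.2 (hall l hla)))).1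
        have hmk := (abs_le.1 (h.mean k t ht'.le (Finset.nonempty_iff_ne_empty.2 hemp))).2
        unfold ucb at hucb
        have hn : (0 : ℝ) < (pulls x φ t k).card := by
          exact_mod_cast Finset.card_pos.2 (Finset.nonempty_iff_ne_empty.2 hemp)
        -- The chain mean l ≤ ucb l ≤ ucb k ≤ mean k + 2 (width of k) forces the width of k to be at
        -- least D/2.
        have hw : D / 2 ≤ √(Real.log (T / δ) / (2 * (pulls x φ t k).card)) := by linarith
        rw [Real.le_sqrt' (by positivity), le_div_iff₀ (by positivity)] at hw
        have : ((pulls x φ t k).card : ℝ) ≤ 2 * Real.log (T / δ) / D ^ 2 := by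
          rw [le_div_iff₀ (by positivity)]
          linarith
        push_cast
        linarith
    · rw [add_zero]
      exact ih ht'.le

end IsGoodRun

/-- Standing assumptions on the mean reward function and on the parameters. -/
structure Setting (m : I → ℝ) (M L Q p : ℝ) (N K T : ℕ) (δ : ℝ) : Prop where
  measurable : Measurable m
  mem_Icc : ∀ x, m x ∈ Set.Icc (0 : ℝ) 1
  threshold_mem : M ∈ Set.Icc (0 : ℝ) 1
  L_pos : 0 < L
  weakLipschitz : WeakLipschitz m M L
  margin : Margin m M Q
  volume_eq : (volume : Measure I).real {x | M ≤ m x} = p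
  p_pos : 0 < p
  p_lt_one : p < 1
  budget : (T : ℝ) = N * p
  K_pos : 0 < K
  arms : (4 : ℝ) * K ≤ N
  sq_le : (K : ℝ) ^ 2 ≤ N
  log_nonneg : 0 ≤ Real.log (T / δ)
  log_le : Real.log (T / δ) * K ^ 3 ≤ 3 * N

namespace Setting

variable {N K : ℕ} {m : I → ℝ} {M L Q p : ℝ} {T : ℕ} {δ : ℝ} {x : Fin N → I}
    {r : Fin N → ℝ} {φ : ℕ → Fin N} {sel : ℕ → Fin K}

theorem K_pos' (s : Setting m M L Q p N K T δ) : (0 : ℝ) < K := by exact_mod_cast s.K_pos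

/-- Unless all cells qualify, the qualifying ones cover the superlevel set of M, of measure p, and a
strip below it of measure at least 2/K. The surplus 2N/K of expected arms absorbs the fluctuation
N/(2K). -/
theorem le_card_topCells (s : Setting m M L Q p N K T δ) (h : IsGoodRun m M L T δ x r φ sel) :
    (T : ℝ) ≤ ({i | ∃ l, x i ∈ cell K l ∧ M - 4 * L / K ≤ cellMean m l} : Set (Fin N)).ncard := by
  classical
  have hK := s.K_pos'
  have hL := s.L_pos
  set U := topCells m K (M - 4 * L / K) with hU
  have hset : ({i | ∃ l, x i ∈ cell K l ∧ M - 4 * L / K ≤ cellMean m l} : Set (Fin N)) =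
      ((({i | x i ∈ cells K U} : Finset (Fin N))) : Set (Fin N)) := by
    ext i
    simp [mem_cells, hU, topCells, and_comm]
  rw [hset, Set.ncard_coe_finset]
  by_cases hall : ∀ l : Fin K, M - 4 * L / K ≤ cellMean m l
  · have : ({i | x i ∈ cells K U} : Finset (Fin N)) = Finset.univ := by
      refine Finset.filter_true_of_mem fun i _ => ?_
      obtain ⟨l, hl⟩ := exists_mem_cell s.K_pos (x i)
      exact mem_cells.2 ⟨l, Finset.mem_filter.2 ⟨Finset.mem_univ _, hall l⟩, hl⟩
    rw [this, Finset.card_univ, Fintype.card_fin, s.budget]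
    exact mul_le_of_le_one_right (Nat.cast_nonneg _) s.p_lt_one.le
  · push Not at hall
    obtain ⟨l, hl⟩ := hall
    obtain ⟨y, hy⟩ := cell_nonempty l
    have hLK : 0 < L / K := by positivity
    have e4 : 4 * L / K = 4 * (L / K) := by ring
    have hyM : m y < M := lt_of_cellMean_lt hL s.weakLipschitz s.measurable s.mem_Icc hy (by linarith)
    have hylt : m y < M - 2 * (L / K) := by
      by_contra hge
      push Not at hge
      have := abs_cellMean_sub_le hL s.weakLipschitz s.measurable s.mem_Icc hy
        (u := 2 * (L / K)) (by linarith) (by rw [abs_le]; constructor <;> linarith)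
      linarith [(abs_le.1 this).1]
    have hne : {x | M ≤ m x}.Nonempty := by
      rw [Set.nonempty_iff_ne_empty]
      intro he
      have := s.volume_eq
      rw [he, measureReal_empty] at this
      exact s.p_pos.ne this
    have hstrip := le_volume_strip_below hL s.weakLipschitz hne (by positivity) hylt
    have hdisj : Disjoint {x | M ≤ m x} {w | M - 2 * (L / K) ≤ m w ∧ m w < M} :=
      Set.disjoint_left.2 fun w hw hw' => absurd hw'.2 (not_lt.2 hw)
    have hmeas : MeasurableSet {w | M - 2 * (L / K) ≤ m w ∧ m w < M} :=
      (measurableSet_le measurable_const s.measurable).inter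
        (measurableSet_lt s.measurable measurable_const)
    have hsub : {x | M ≤ m x} ∪ {w | M - 2 * (L / K) ≤ m w ∧ m w < M} ⊆ cells K U := fun w hw => by
      obtain ⟨l', hl'⟩ := exists_mem_cell s.K_pos w
      refine mem_cells.2 ⟨l', ?_, hl'⟩
      simp only [hU, topCells, Finset.mem_filter, Finset.mem_univ, true_and]
      by_contra hlt
      push Not at hlt
      have hwM := lt_of_cellMean_lt hL s.weakLipschitz s.measurable s.mem_Icc hl' (by linarith)
      have hw2 : M - 2 * (L / K) ≤ m w := by
        rcases hw with hw | hw
        · exact absurd hw (not_le.2 hwM)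
        · exact hw.1
      have := abs_cellMean_sub_le hL s.weakLipschitz s.measurable s.mem_Icc hl'
        (u := 2 * (L / K)) (by linarith) (by rw [abs_le]; constructor <;> linarith)
      linarith [(abs_le.1 this).1]
    have hvol := measureReal_mono (μ := (volume : Measure I)) hsub
    rw [measureReal_union hdisj hmeas, s.volume_eq] at hvol
    have hcount := (abs_le.1 (h.count U (by simp [testFamilies, hU]))).1
    have h2 : 2 * (L / K) / L = 2 / K := by field_simp
    rw [h2] at hstrip
    have h3 : (N : ℝ) * (p + 2 / K) ≤ N * (volume : Measure I).real (cells K U) := by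
      gcongr
      linarith
    have h4 : (N : ℝ) * (p + 2 / K) = T + 4 * (N / (2 * K)) := by
      rw [s.budget]; field_simp; ring
    have h5 : (0 : ℝ) ≤ N / (2 * K) := by positivity
    linarith

/-- Pigeonhole: fewer than T arms have been pulled, so some arm of the cells counted in
`le_card_topCells` remains. -/
theorem exists_alive (s : Setting m M L Q p N K T δ) (h : IsGoodRun m M L T δ x r φ sel) {t : ℕ}
    (ht : t < T) : ∃ l : Fin K, Alive x φ t l ∧ M - 4 * L / K ≤ cellMean m l := by
  classical
  have h1 := s.le_card_topCells h
  have h2 : ((Finset.range t).image φ : Set (Fin N)).ncard <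
      ({i | ∃ l, x i ∈ cell K l ∧ M - 4 * L / K ≤ cellMean m l} : Set (Fin N)).ncard := by
    rw [Set.ncard_coe_finset]
    refine lt_of_le_of_lt Finset.card_image_le ?_
    rw [Finset.card_range]
    exact_mod_cast lt_of_lt_of_le (Nat.cast_lt.2 ht) h1
  obtain ⟨i, ⟨l, hl, hml⟩, hi⟩ := Set.exists_mem_notMem_of_ncard_lt_ncard h2
  refine ⟨l, h.alive s.arms hl fun u hu he => hi ?_, hml⟩
  simp only [Finset.coe_image, Finset.coe_range, Set.mem_image, Set.mem_Iio]
  exact ⟨u, hu, he⟩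

/-- The cells of mean at least M + Δ/2 lie above height M + Δ/8. The strip between M and that height
is disjoint from them, has measure at least Δ/(8L), and fits with them in the superlevel set of
measure p. -/
theorem volume_topCells_le (s : Setting m M L Q p N K T δ) {k : Fin K}
    (hk : 8 * (L / K) < cellMean m k - M) :
    (volume : Measure I).real (cells K (topCells m K ((M + cellMean m k) / 2))) +
      (cellMean m k - M) / (8 * L) ≤ p := by
  have hK := s.K_pos'
  have hL := s.L_pos
  have hLK : 0 < L / K := by positivity
  set Δ := cellMean m k - M with hΔ
  have habove : ∀ l : Fin K, M + Δ / 2 ≤ cellMean m l → ∀ y ∈ cell K l, M + Δ / 8 < m y := by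
    intro l hl y hy
    have h1 := lt_of_lt_cellMean hL s.weakLipschitz s.measurable s.mem_Icc hy (by linarith)
    by_contra hle
    push Not at hle
    have := abs_cellMean_sub_le hL s.weakLipschitz s.measurable s.mem_Icc hy
      (u := Δ / 8) (by linarith) (by rw [abs_le]; constructor <;> linarith)
    linarith [(abs_le.1 this).2]
  have hne : {x | m x < M}.Nonempty := by
    rw [Set.nonempty_iff_ne_empty]
    intro he
    have h1 := s.volume_eq
    have : {x | M ≤ m x} = Set.univ := Set.eq_univ_of_forall fun w => by
      by_contra hw
      have : w ∈ ({x | m x < M} : Set I) := (not_le.1 hw : m w < M)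
      rw [he] at this
      exact this
    rw [this, probReal_univ] at h1
    exact s.p_lt_one.ne h1.symm
  obtain ⟨y, hy⟩ := cell_nonempty k
  have hstrip := le_volume_strip_above hL s.weakLipschitz hne (by linarith)
    (habove k (by linarith) y hy)
  rw [div_div] at hstrip
  have hmeas : MeasurableSet {w | M ≤ m w ∧ m w ≤ M + Δ / 8} :=
    (measurableSet_le measurable_const s.measurable).inter
      (measurableSet_le s.measurable measurable_const)
  have htop : ∀ w ∈ cells K (topCells m K ((M + cellMean m k) / 2)), M + Δ / 8 < m w := by
    intro w hw
    obtain ⟨l, hl, hwl⟩ := mem_cells.1 hw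
    simp only [topCells, Finset.mem_filter, Finset.mem_univ, true_and] at hl
    exact habove l (by linarith) w hwl
  have hdisj : Disjoint (cells K (topCells m K ((M + cellMean m k) / 2)))
      {w | M ≤ m w ∧ m w ≤ M + Δ / 8} :=
    Set.disjoint_left.2 fun w hw hw' => absurd (htop w hw) (not_lt.2 hw'.2)
  have hsub : cells K (topCells m K ((M + cellMean m k) / 2)) ∪
      {w | M ≤ m w ∧ m w ≤ M + Δ / 8} ⊆ {x | M ≤ m x} := by
    rintro w (hw | hw)
    · have := htop w hw
      rw [Set.mem_ofPred_eq]
      linarith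
    · exact hw.1
  have hvol := measureReal_mono (μ := (volume : Measure I)) hsub
  rw [measureReal_union hdisj hmeas, s.volume_eq] at hvol
  linarith

/-- Cells at distance at most `nearConst L Q / K` of the threshold are those which may be
misclassified. -/
def nearConst (L Q : ℝ) : ℝ := 1 + 8 * L * (2 + 96 * max Q 1)

theorem one_le_nearConst (hL : 0 < L) : 1 ≤ nearConst L Q := by
  unfold nearConst
  have : 0 ≤ max Q 1 := zero_le_one.trans (le_max_right _ _)
  have : 0 ≤ 8 * L * (2 + 96 * max Q 1) := by positivity
  linarith

theorem mul_lt_nearConst (hL : 0 < L) : 8 * L < nearConst L Q := by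
  unfold nearConst
  have : 0 ≤ max Q 1 := zero_le_one.trans (le_max_right _ _)
  have : 0 ≤ 8 * L * (1 + 96 * max Q 1) := by positivity
  linarith

/-- The cells well above the threshold are exhausted at the end of the run. -/
theorem exhausted (s : Setting m M L Q p N K T δ) (h : IsGoodRun m M L T δ x r φ sel) {k : Fin K}
    (hk : nearConst L Q / K < cellMean m k - M) {i : Fin N} (hi : x i ∈ cell K k) :
    ∃ t < T, φ t = i := by
  classical
  by_contra hne
  push Not at hne
  have hK := s.K_pos'
  have hL := s.L_pos
  have hLK : 0 < L / K := by positivity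
  set q := max Q 1 with hq
  have hq1 : 1 ≤ q := le_max_right _ _
  set C := nearConst L Q with hC
  have hC1 : 1 ≤ C := one_le_nearConst hL
  set Δ := cellMean m k - M with hΔ
  set ℓ := Real.log (T / δ) with hℓ
  have hℓ0 : 0 ≤ ℓ := s.log_nonneg
  have h8 : 8 * (L / K) < Δ := by
    refine lt_trans ?_ hk
    rw [← mul_div_assoc]
    gcongr
    exact mul_lt_nearConst hL
  have hΔ0 : 0 < Δ := by linarith
  have halive : ∀ t < T, Alive x φ t k := fun t ht =>
    h.alive s.arms hi fun u hu => hne u (hu.trans ht)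
  -- Cells outside H are worse than the alive cell k by at least Δ/2 and are rarely pulled; cells in
  -- H are limited by their supply of arms.
  set H := topCells m K ((M + cellMean m k) / 2) with hH
  have hnotin : ∀ l ∉ H, cellMean m l < M + Δ / 2 := fun l hl => by
    simp only [hH, topCells, Finset.mem_filter, Finset.mem_univ, true_and] at hl
    push Not at hl
    linarith
  have hlow : ∑ l ∈ Hᶜ, ((pulls x φ T l).card : ℝ) ≤ K + 2 * ℓ * (16 * q * K / Δ) := by
    have h1 : ∀ l ∈ Hᶜ, ((pulls x φ T l).card : ℝ) ≤
        1 + 2 * ℓ * (1 / (cellMean m k - cellMean m l) ^ 2) := fun l hl => by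
      have hl := hnotin l (Finset.mem_compl.1 hl)
      rw [mul_one_div]
      exact h.card_pulls_le hℓ0 (by linarith) fun t ht => ⟨k, halive t ht, by linarith⟩
    have h2 : ∑ l ∈ Hᶜ, 1 / (cellMean m k - cellMean m l) ^ 2 ≤ 4 * (2 * q * K) / (Δ / 2) := by
      refine sum_inv_sq_le_dyadic Hᶜ (fun l => cellMean m k - cellMean m l) (by linarith)
        (fun l hl => ?_) (by positivity) fun u hu => ?_
      · have := hnotin l (Finset.mem_compl.1 hl)
        linarith
      · refine le_trans ?_ (card_cells_near_le hL s.weakLipschitz s.measurable s.mem_Icc s.margin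
          s.K_pos (u := u) (by linarith))
        norm_cast
        refine Finset.card_le_card fun l hl => ?_
        rw [Finset.mem_filter] at hl ⊢
        have := hnotin l (Finset.mem_compl.1 hl.1)
        refine ⟨Finset.mem_univ _, ?_⟩
        rw [abs_le]
        constructor <;> linarith [hl.2]
    calc ∑ l ∈ Hᶜ, ((pulls x φ T l).card : ℝ)
        ≤ ∑ l ∈ Hᶜ, (1 + 2 * ℓ * (1 / (cellMean m k - cellMean m l) ^ 2)) := Finset.sum_le_sum h1
      _ = (Hᶜ.card : ℝ) + 2 * ℓ * ∑ l ∈ Hᶜ, 1 / (cellMean m k - cellMean m l) ^ 2 := by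
          rw [Finset.sum_add_distrib, Finset.mul_sum]
          simp
      _ ≤ K + 2 * ℓ * (4 * (2 * q * K) / (Δ / 2)) := by
          gcongr
          exact (Finset.card_le_univ _).trans_eq (Fintype.card_fin K)
      _ = _ := by field_simp; ring
  have hhigh : ∑ l ∈ H, ((pulls x φ T l).card : ℝ) ≤ N * (p - Δ / (8 * L)) + N / (2 * K) := by
    have h1 : ∑ l ∈ H, (pulls x φ T l).card ≤ ({i | x i ∈ cells K H} : Finset (Fin N)).card := by
      refine (Finset.sum_le_sum fun l _ => h.card_pulls_le_card_armsIn l).trans ?_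
      rw [← Finset.card_biUnion]
      · refine Finset.card_le_card fun j hj => ?_
        obtain ⟨l, hl, hj⟩ := Finset.mem_biUnion.1 hj
        exact Finset.mem_filter.2 ⟨Finset.mem_univ _, mem_cells.2 ⟨l, hl, mem_armsIn.1 hj⟩⟩
      · intro l _ l' _ hll'
        exact Finset.disjoint_left.2 fun j hj hj' =>
          hll' (eq_of_mem_cell (mem_armsIn.1 hj) (mem_armsIn.1 hj'))
    have h2 := (abs_le.1 (h.count H (by simp [testFamilies, hH]))).2
    have h3 : (N : ℝ) * (volume : Measure I).real (cells K H) ≤ N * (p - Δ / (8 * L)) := by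
      gcongr
      linarith [s.volume_topCells_le h8]
    have h4 : ∑ l ∈ H, ((pulls x φ T l).card : ℝ) ≤
        (({i | x i ∈ cells K H} : Finset (Fin N)).card : ℝ) := by exact_mod_cast h1
    linarith
  have htot : ∑ l : Fin K, ((pulls x φ T l).card : ℝ) = T := by exact_mod_cast h.sum_card_pulls
  rw [← Finset.sum_add_sum_compl H, s.budget] at htot
  -- The pulls inside and outside H add up to T = Np, so the supply missing from H must be made up
  -- by the rare pulls and the fluctuation. All terms on the right turn out to be O(N/K).
  have hmain : N * (Δ / (8 * L)) ≤ N / (2 * K) + K + 2 * ℓ * (16 * q * K / Δ) := by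
    linarith
  have hb1 : (K : ℝ) ≤ N / K := by
    rw [le_div_iff₀ hK]; linarith [s.sq_le]
  have hb2 : 2 * ℓ * (16 * q * K / Δ) ≤ 96 * q * (N / K) := by
    have hΔK : 1 ≤ Δ * K := by
      rw [div_lt_iff₀ hK] at hk
      linarith
    have hdiv : 16 * q * K / Δ ≤ 16 * q * K ^ 2 := by
      rw [div_le_iff₀ hΔ0]
      have : 0 ≤ 16 * q * K := by positivity
      nlinarith
    calc 2 * ℓ * (16 * q * K / Δ) ≤ 2 * ℓ * (16 * q * K ^ 2) := by gcongr
      _ = 32 * q * (ℓ * K ^ 3) / K := by field_simp; ring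
      _ ≤ 32 * q * (3 * N) / K := by
          exact div_le_div_of_nonneg_right (mul_le_mul_of_nonneg_left s.log_le (by positivity)) hK.le
      _ = _ := by ring
  have hN : (0 : ℝ) < N := lt_of_lt_of_le (by positivity) s.arms
  have hfin : N * (Δ / (8 * L)) ≤ (3 / 2 + 96 * q) * (N / K) := by
    have : (N : ℝ) / (2 * K) = 1 / 2 * (N / K) := by field_simp
    linarith
  have hcontra : (3 / 2 + 96 * q) * (N / K) < N * (Δ / (8 * L)) := by
    have h1 : 8 * L * (2 + 96 * q) / K < Δ := by
      refine lt_of_le_of_lt ?_ hk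
      gcongr
      rw [hC, nearConst]
      linarith
    have h2 : (2 + 96 * q) / K < Δ / (8 * L) := by
      rw [lt_div_iff₀ (by positivity)]
      calc (2 + 96 * q) / K * (8 * L) = 8 * L * (2 + 96 * q) / K := by ring
        _ < Δ := h1
    calc (3 / 2 + 96 * q) * (N / K) ≤ (2 + 96 * q) * (N / K) := by
          gcongr
          norm_num
      _ = N * ((2 + 96 * q) / K) := by ring
      _ < _ := by gcongr
  linarith

end Setting

open Classical in
/-- The regret is at most the sum of the losses, relative to the level `M`, of the arms above `M`
which are not pulled and of the arms below `M` which are pulled. -/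
theorem regret_le {N : ℕ} (m : I → ℝ) (M : ℝ) {T : ℕ} (hT : T ≤ N) (x : Fin N → I) (φ : ℕ → Fin N)
    (hφ : Set.InjOn φ (Finset.range T : Set ℕ)) :
    regret m T x φ ≤ ∑ i, if i ∈ (Finset.range T).image φ then max (M - m (x i)) 0
      else max (m (x i) - M) 0 := by
  set P := (Finset.range T).image φ with hP
  -- Each oracle term is at most M plus its positive excess; extending the sum of excesses to all
  -- arms makes the order irrelevant.
  have h1 : ∑ t : Fin N with t.val < T, m (x (oracle m x t)) ≤
      T * M + ∑ i, max (m (x i) - M) 0 := by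
    have hcard : ({t : Fin N | t.val < T} : Finset (Fin N)).card = T := by
      rw [Fin.card_filter_val_lt]
      omega
    calc ∑ t : Fin N with t.val < T, m (x (oracle m x t))
        ≤ ∑ t : Fin N with t.val < T, (M + max (m (x (oracle m x t)) - M) 0) :=
          Finset.sum_le_sum fun t _ => by linarith [le_max_left (m (x (oracle m x t)) - M) 0]
      _ = T * M + ∑ t : Fin N with t.val < T, max (m (x (oracle m x t)) - M) 0 := by
          rw [Finset.sum_add_distrib, Finset.sum_const, hcard, nsmul_eq_mul]
      _ ≤ T * M + ∑ t : Fin N, max (m (x (oracle m x t)) - M) 0 := by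
          gcongr
          exact Finset.subset_univ _
      _ = _ := by rw [Equiv.sum_comp (oracle m x) fun i => max (m (x i) - M) 0]
  have h2 : ∑ t ∈ Finset.range T, m (x (φ t)) = T * M + ∑ i ∈ P, (m (x i) - M) := by
    rw [hP, Finset.sum_image hφ, Finset.sum_sub_distrib]
    simp
  rw [regret, h2]
  have h3 : ∑ i ∈ P, (m (x i) - M) = ∑ i, if i ∈ P then m (x i) - M else 0 := by
    simp [Finset.sum_ite_mem]
  rw [h3]
  calc _ ≤ ∑ i, max (m (x i) - M) 0 - ∑ i, (if i ∈ P then m (x i) - M else 0) := by linarith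
    _ = ∑ i, if i ∈ P then max (M - m (x i)) 0 else max (m (x i) - M) 0 := by
      rw [← Finset.sum_sub_distrib]
      refine Finset.sum_congr rfl fun i _ => ?_
      split_ifs
      · rcases le_total M (m (x i)) with h | h
        · rw [max_eq_left (by linarith), max_eq_right (by linarith)]; ring
        · rw [max_eq_right (by linarith), max_eq_left (by linarith)]; ring
      · ring

/-! ### Regret on the concentration event. -/

namespace Setting

variable {N K : ℕ} {m : I → ℝ} {M L Q p : ℝ} {T : ℕ} {δ : ℝ} {x : Fin N → I}
    {r : Fin N → ℝ} {φ : ℕ → Fin N} {sel : ℕ → Fin K}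

-- The arms are split by cell. A near cell loses at most 2C/K per arm; a high cell is exhausted and
-- loses nothing; a low cell at depth Δ loses at most 2Δ per pull, with at most 1 + 8 log(T/δ)/Δ²
-- pulls.
open Classical in
theorem regret_le_of_isGoodRun (s : Setting m M L Q p N K T δ)
    (h : IsGoodRun m M L T δ x r φ sel) :
    regret m T x φ ≤ 6 * max Q 1 * nearConst L Q ^ 2 * (N / K ^ 2) + 2 * K +
      64 * max Q 1 * Real.log (T / δ) * K * (Nat.log 2 K + 1) := by
  have hK := s.K_pos'
  have hL := s.L_pos
  have hLK : 0 < L / K := by positivity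
  set q := max Q 1 with hq
  have hq1 : 1 ≤ q := le_max_right _ _
  set C := nearConst L Q with hC
  have hC1 : 1 ≤ C := one_le_nearConst hL
  have hC8 : 8 * L < C := mul_lt_nearConst hL
  have hCK : 8 * (L / K) < C / K := by
    rw [← mul_div_assoc]
    gcongr
  set ℓ := Real.log (T / δ) with hℓ
  have hℓ0 : 0 ≤ ℓ := s.log_nonneg
  have hN : (0 : ℝ) < N := lt_of_lt_of_le (by positivity) s.arms
  have hTN : T ≤ N := by
    have : (T : ℝ) ≤ N := by
      rw [s.budget]
      exact mul_le_of_le_one_right hN.le s.p_lt_one.le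
    exact_mod_cast this
  set P := (Finset.range T).image φ with hP
  let f : Fin N → ℝ := fun i => if i ∈ P then max (M - m (x i)) 0 else max (m (x i) - M) 0
  have hfabs : ∀ i, f i ≤ |m (x i) - M| := fun i => by
    simp only [f]
    split_ifs
    · exact max_le (by rw [abs_sub_comm]; exact le_abs_self _) (abs_nonneg _)
    · exact max_le (le_abs_self _) (abs_nonneg _)
  have hmean : ∀ k : Fin K, cellMean m k ∈ Set.Icc (0 : ℝ) 1 := fun k =>
    ⟨le_cellMean s.measurable s.mem_Icc fun y _ => (s.mem_Icc y).1,
      cellMean_le s.measurable s.mem_Icc fun y _ => (s.mem_Icc y).2⟩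
  let near : Finset (Fin K) := {k | |cellMean m k - M| ≤ C / K}
  let low : Finset (Fin K) := {k | cellMean m k < M - C / K}
  have hcell : ∀ k : Fin K, ∑ i ∈ armsIn x k, f i ≤
      (if k ∈ near then 3 * C * (N / K ^ 2) else 0) +
      if k ∈ low then 2 + 16 * ℓ * (1 / (M - cellMean m k)) else 0 := by
    intro k
    have hlowpos : 0 ≤ if k ∈ low then 2 + 16 * ℓ * (1 / (M - cellMean m k)) else 0 := by
      split_ifs with hk
      · have hk : cellMean m k < M - C / K := (Finset.mem_filter.1 hk).2
        have : 0 < M - cellMean m k := by linarith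
        positivity
      · exact le_rfl
    have hnearpos : 0 ≤ if k ∈ near then 3 * C * ((N : ℝ) / K ^ 2) else 0 := by
      split_ifs
      · positivity
      · exact le_rfl
    by_cases hnear : |cellMean m k - M| ≤ C / K
    · have hk : k ∈ near := Finset.mem_filter.2 ⟨Finset.mem_univ _, hnear⟩
      rw [if_pos hk]
      have hcard : ((armsIn x k).card : ℝ) ≤ 3 / 2 * (N / K) := by
        have h1 := (abs_le.1 (h.card_armsIn k)).2
        have : (N : ℝ) / (2 * K) = 1 / 2 * (N / K) := by field_simp
        linarith
      have : ∑ i ∈ armsIn x k, f i ≤ 3 * C * (N / K ^ 2) := by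
        calc ∑ i ∈ armsIn x k, f i ≤ ∑ _i ∈ armsIn x k, 2 * (C / K) := by
              refine Finset.sum_le_sum fun i hi => (hfabs i).trans ?_
              exact abs_sub_le_of_abs_cellMean_sub_le hL s.weakLipschitz s.measurable s.mem_Icc
                (mem_armsIn.1 hi) (by linarith) hnear
          _ = (armsIn x k).card * (2 * (C / K)) := by rw [Finset.sum_const, nsmul_eq_mul]
          _ ≤ 3 / 2 * (N / K) * (2 * (C / K)) := by gcongr
          _ = _ := by field_simp
      linarith
    rcases lt_abs.1 (not_le.1 hnear) with hhigh | hlow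
    · have : ∑ i ∈ armsIn x k, f i = 0 := by
        refine Finset.sum_eq_zero fun i hi => ?_
        have hi := mem_armsIn.1 hi
        obtain ⟨t, ht, hti⟩ := s.exhausted h hhigh hi
        have hiP : i ∈ P := Finset.mem_image.2 ⟨t, Finset.mem_range.2 ht, hti⟩
        have hgt := lt_of_lt_cellMean hL s.weakLipschitz s.measurable s.mem_Icc hi (by linarith)
        simp only [f, if_pos hiP]
        exact max_eq_right (by linarith)
      linarith
    · have hk : k ∈ low := Finset.mem_filter.2 ⟨Finset.mem_univ _, by linarith⟩
      rw [if_pos hk]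
      set Δ := M - cellMean m k with hΔ
      have hΔC : C / K < Δ := by linarith
      have hΔ0 : 0 < Δ := lt_trans (by positivity) hΔC
      have hΔ1 : Δ ≤ 1 := by linarith [(hmean k).1, s.threshold_mem.2]
      -- The alive competitor has mean at least M - 4L/K, and Δ > 8L/K, so its advantage is at least
      -- Δ/2.
      have hpulls : ((pulls x φ T k).card : ℝ) ≤ 1 + 2 * ℓ / (Δ / 2) ^ 2 := by
        refine h.card_pulls_le hℓ0 (by positivity) fun t ht => ?_
        obtain ⟨l, hl, hml⟩ := s.exists_alive h ht
        refine ⟨l, hl, ?_⟩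
        have : 4 * L / K = 4 * (L / K) := by ring
        linarith
      have hPk : (((armsIn x k).filter (· ∈ P)).card : ℝ) ≤ (pulls x φ T k).card := by
        have : (armsIn x k).filter (· ∈ P) ⊆ (pulls x φ T k).image φ := fun i hi => by
          obtain ⟨hi, hiP⟩ := Finset.mem_filter.1 hi
          obtain ⟨t, ht, rfl⟩ := Finset.mem_image.1 hiP
          exact Finset.mem_image.2 ⟨t, Finset.mem_filter.2 ⟨ht, mem_armsIn.1 hi⟩, rfl⟩
        exact_mod_cast (Finset.card_le_card this).trans Finset.card_image_le
      have : ∑ i ∈ armsIn x k, f i ≤ 2 + 16 * ℓ * (1 / Δ) := by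
        calc ∑ i ∈ armsIn x k, f i ≤ ∑ i ∈ armsIn x k, if i ∈ P then 2 * Δ else 0 := by
              refine Finset.sum_le_sum fun i hi => ?_
              have hi := mem_armsIn.1 hi
              split_ifs with hiP
              · refine (hfabs i).trans ?_
                refine abs_sub_le_of_abs_cellMean_sub_le hL s.weakLipschitz s.measurable s.mem_Icc
                  hi (by linarith) ?_
                rw [abs_le]
                constructor <;> linarith
              · have := lt_of_cellMean_lt hL s.weakLipschitz s.measurable s.mem_Icc hi
                  (by linarith)
                simp only [f, if_neg hiP]
                exact (max_eq_right (by linarith)).le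
          _ = ((armsIn x k).filter (· ∈ P)).card * (2 * Δ) := by
              rw [← Finset.sum_filter, Finset.sum_const, nsmul_eq_mul]
          _ ≤ (1 + 2 * ℓ / (Δ / 2) ^ 2) * (2 * Δ) := by
              gcongr
              exact hPk.trans hpulls
          _ = 2 * Δ + 16 * ℓ * (1 / Δ) := by field_simp; ring
          _ ≤ _ := by linarith
      linarith
  have hnear : ∑ k, (if k ∈ near then 3 * C * ((N : ℝ) / K ^ 2) else 0) ≤
      6 * q * C ^ 2 * (N / K ^ 2) := by
    rw [← Finset.sum_filter, Finset.sum_const, nsmul_eq_mul, Finset.filter_univ_mem]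
    have hcard := card_cells_near_le hL s.weakLipschitz s.measurable s.mem_Icc s.margin s.K_pos
      (u := C / K) (by linarith)
    calc (near.card : ℝ) * (3 * C * (N / K ^ 2)) ≤
          (2 * q * K * (C / K)) * (3 * C * (N / K ^ 2)) := by gcongr
      _ = _ := by field_simp; ring
  have hlow : ∑ k, (if k ∈ low then 2 + 16 * ℓ * (1 / (M - cellMean m k)) else 0) ≤
      2 * K + 64 * q * ℓ * K * (Nat.log 2 K + 1) := by
    have hsum : ∑ k ∈ low, 1 / (M - cellMean m k) ≤ 2 * (2 * q * K) * ((Nat.log 2 K + 1 : ℕ) : ℝ) := by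
      refine sum_inv_le_dyadic low (fun k => M - cellMean m k) (d₀ := C / K) (by positivity)
        (fun k hk => ?_) (fun k hk => ?_) fun u hu => ?_
      · have : cellMean m k < M - C / K := (Finset.mem_filter.1 hk).2
        linarith
      -- Depths range from C/K to 1, which `Nat.log 2 K + 1` dyadic scales cover because C ≥ 1.
      · have h1 : (K : ℝ) < 2 ^ (Nat.log 2 K + 1) := by
          exact_mod_cast Nat.lt_pow_succ_log_self one_lt_two K
        have h2 : 1 < 2 ^ (Nat.log 2 K + 1) * (C / K) := by
          rw [← mul_div_assoc, one_lt_div hK]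
          exact h1.trans_le (le_mul_of_one_le_right (by positivity) hC1)
        linarith [(hmean k).1, s.threshold_mem.2]
      · refine le_trans ?_ (card_cells_near_le hL s.weakLipschitz s.measurable s.mem_Icc s.margin
          s.K_pos (u := u) (by linarith))
        norm_cast
        refine Finset.card_le_card fun k hk => ?_
        rw [Finset.mem_filter] at hk ⊢
        have : cellMean m k < M - C / K := (Finset.mem_filter.1 hk.1).2
        have : 0 < C / K := by positivity
        refine ⟨Finset.mem_univ _, ?_⟩
        rw [abs_le]
        constructor <;> linarith [hk.2]
    rw [← Finset.sum_filter, Finset.filter_univ_mem, Finset.sum_add_distrib, ← Finset.mul_sum,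
      Finset.sum_const, nsmul_eq_mul]
    have hcard : (low.card : ℝ) ≤ K := by
      exact_mod_cast (Finset.card_le_univ low).trans_eq (Fintype.card_fin K)
    push_cast at hsum
    calc (low.card : ℝ) * 2 + 16 * ℓ * ∑ k ∈ low, 1 / (M - cellMean m k)
        ≤ K * 2 + 16 * ℓ * (2 * (2 * q * K) * (Nat.log 2 K + 1)) := by gcongr
      _ = _ := by ring
  have hpart : ∑ i, f i = ∑ k : Fin K, ∑ i ∈ armsIn x k, f i := by
    rw [← Finset.sum_biUnion]
    · refine Finset.sum_congr (Finset.ext fun i => ?_) fun _ _ => rfl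
      obtain ⟨k, hk⟩ := exists_mem_cell s.K_pos (x i)
      simp only [Finset.mem_univ, true_iff, Finset.mem_biUnion, true_and]
      exact ⟨k, mem_armsIn.2 hk⟩
    · intro l _ l' _ hll'
      exact Finset.disjoint_left.2 fun j hj hj' =>
        hll' (eq_of_mem_cell (mem_armsIn.1 hj) (mem_armsIn.1 hj'))
  calc regret m T x φ ≤ ∑ i, f i := regret_le m M hTN x φ h.injOn
    _ ≤ ∑ k : Fin K, ((if k ∈ near then 3 * C * ((N : ℝ) / K ^ 2) else 0) +
      if k ∈ low then 2 + 16 * ℓ * (1 / (M - cellMean m k)) else 0) :=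
        hpart.trans_le (Finset.sum_le_sum fun k _ => hcell k)
    _ ≤ _ := by
        rw [Finset.sum_add_distrib]
        linarith

end Setting

/-! ### Probability of the concentration event -/

section GoodEvent

variable {Ω : Type*} [mΩ : MeasurableSpace Ω] {μ : Measure Ω} [IsProbabilityMeasure μ] {N : ℕ}
  {m : I → ℝ} {a : Fin N → Ω → I} {y : Fin N → Ω → ℝ} {T K : ℕ} {δ : ℝ} {φ : ℕ → Ω → Fin N}

/-- Union bound: KT pairs of a cell and a number of pulls, each failing with probability at most
2δ/T, and at most 2K + 1 families, each failing with probability at most 2 exp(-N/(2K²)). -/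
theorem le_measure_isGoodRun (hE : IsEnvironment μ m a y) (hm : Measurable m)
    (hm01 : ∀ x, m x ∈ Set.Icc (0 : ℝ) 1) (hA : IsUCBF μ a y T K δ φ) (M L : ℝ) (hT : 0 < T)
    (hδ : 0 < δ) (hl : 0 ≤ Real.log (T / δ)) :
    1 - (2 * K * δ + (4 * K + 2) * Real.exp (-(N / (2 * K ^ 2)))) ≤
      μ.real {ω | ∃ sel : ℕ → Fin K, IsGoodRun m M L T δ (fun i => a i ω) (fun i => y i ω)
        (fun t => φ t ω) sel} := by
  classical
  set G := {ω | ∃ sel : ℕ → Fin K, IsGoodRun m M L T δ (fun i => a i ω) (fun i => y i ω)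
        (fun t => φ t ω) sel} with hG
  have hT' : (0 : ℝ) < T := by exact_mod_cast hT
  let w : ℕ → ℝ := fun n => √(Real.log (T / δ) / (2 * n))
  let B1 : Fin K → ℕ → Set Ω := fun k n => {ω | (∀ i, y i ω ∈ Set.Icc (0 : ℝ) 1) ∧
      ∃ t ≤ T, (pulls (fun i => a i ω) (fun s => φ s ω) t k).card = n ∧
      w n < |empMean (fun i => a i ω) (fun i => y i ω) (fun s => φ s ω) t k - cellMean m k|}
  let B2 : Finset (Fin K) → Set Ω := fun S => {ω | (N : ℝ) / (2 * K) ≤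
    |(({i | a i ω ∈ cells K S} : Finset (Fin N)).card : ℝ) -
      N * (volume : Measure I).real (cells K S)|}
  have hB1 : ∀ k, ∀ n ∈ Finset.Icc 1 T, μ.real (B1 k n) ≤ 2 * (δ / T) := fun k n hn => by
    have hn0 : 0 < n := (Finset.mem_Icc.1 hn).1
    have hn' : (0 : ℝ) < n := by exact_mod_cast hn0
    refine (measure_empMean_deviation_le hE hm hm01 hA k hn0 (Real.sqrt_nonneg _)).trans_eq ?_
    rw [Real.sq_sqrt (by positivity), mul_div_cancel₀ _ (by positivity), Real.exp_neg,
      Real.exp_log (by positivity), inv_div]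
  have hB2 : ∀ S, μ.real (B2 S) ≤ 2 * Real.exp (-(N / (2 * K ^ 2))) := fun S => by
    refine (measure_card_deviation_le hE (measurableSet_cells K S) (by positivity)).trans_eq ?_
    congr 3
    rcases Nat.eq_zero_or_pos N with hN | hN
    · simp [hN]
    · have hN' : (N : ℝ) ≠ 0 := by exact_mod_cast hN.ne'
      field_simp
  set Bad : Set Ω := (⋃ k ∈ (Finset.univ : Finset (Fin K)), ⋃ n ∈ Finset.Icc 1 T, B1 k n) ∪
    ⋃ S ∈ testFamilies m M L K, B2 S with hBad
  have hbadle : μ.real Bad ≤ 2 * K * δ + (4 * K + 2) * Real.exp (-(N / (2 * K ^ 2))) := by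
    refine (measureReal_union_le _ _).trans (add_le_add ?_ ?_)
    · refine (measureReal_biUnion_finset_le _ _).trans ?_
      calc ∑ k : Fin K, μ.real (⋃ n ∈ Finset.Icc 1 T, B1 k n)
          ≤ ∑ _k : Fin K, ∑ _n ∈ Finset.Icc 1 T, 2 * (δ / T) :=
            Finset.sum_le_sum fun k _ =>
              (measureReal_biUnion_finset_le _ _).trans (Finset.sum_le_sum (hB1 k))
        _ = 2 * K * δ := by
            simp only [Finset.sum_const, Nat.card_Icc, Finset.card_univ, Fintype.card_fin,
              nsmul_eq_mul, Nat.add_sub_cancel]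
            field_simp
    · refine (measureReal_biUnion_finset_le _ _).trans ((Finset.sum_le_sum fun S _ => hB2 S).trans ?_)
      rw [Finset.sum_const, nsmul_eq_mul]
      have : ((testFamilies m M L K).card : ℝ) ≤ 2 * K + 1 := by
        exact_mod_cast card_testFamilies_le m M L K
      calc _ ≤ (2 * (K : ℝ) + 1) * (2 * Real.exp (-(N / (2 * K ^ 2)))) := by gcongr
        _ = _ := by ring
  have hae : ∀ᵐ ω ∂μ, ω ∈ G ∪ Bad := by
    obtain ⟨ℱ, sel, ha, hy, hstep⟩ := hA
    have hsel : ∀ᵐ ω ∂μ, ∀ t < T,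
        MaySelect (fun i => a i ω) (fun i => y i ω) (fun s => φ s ω) T δ t (sel t ω) := by
      rw [ae_all_iff]
      intro t
      by_cases ht : t < T
      · filter_upwards [(hstep t ht).2.2.1] with ω hω _ using hω
      · exact .of_forall fun ω h => absurd h ht
    have hmem : ∀ᵐ ω ∂μ, ∀ t < T,
        φ t ω ∈ remaining (fun i => a i ω) (fun s => φ s ω) t (sel t ω) := by
      rw [ae_all_iff]
      intro t
      by_cases ht : t < T
      · filter_upwards [ae_mem_remaining ((hstep t ht).2.1.mono (ℱ.le _) le_rfl)
          (hstep t ht).2.2.2] with ω hω _ using hω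
      · exact .of_forall fun ω h => absurd h ht
    filter_upwards [hsel, hmem, ae_reward_mem hE] with ω h1 h2 h3
    by_cases hbad : ω ∈ Bad
    · exact Or.inr hbad
    · left
      rw [hBad, Set.mem_union, not_or] at hbad
      refine ⟨fun t => sel t ω, h1, h2, fun k t ht hne => ?_, fun S hS => ?_⟩
      · by_contra hlt
        push Not at hlt
        refine hbad.1 ?_
        simp only [Set.mem_iUnion]
        refine ⟨k, Finset.mem_univ _, (pulls (fun i => a i ω) (fun s => φ s ω) t k).card, ?_, h3, t,
          ht, rfl, hlt⟩
        rw [Finset.mem_Icc]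
        refine ⟨hne.card_pos, ?_⟩
        refine (Finset.card_filter_le _ _).trans ?_
        rwa [Finset.card_range]
      · by_contra hlt
        push Not at hlt
        refine hbad.2 ?_
        simp only [Set.mem_iUnion]
        exact ⟨S, hS, hlt.le⟩
  have h1 : μ.real (G ∪ Bad) = 1 := by
    have hcongr : (G ∪ Bad : Set Ω) =ᵐ[μ] Set.univ := Filter.eventuallyEq_univ.2 hae
    rw [measureReal_congr hcongr, probReal_univ]
  have h2 := measureReal_union_le (μ := μ) G Bad
  linarith

end GoodEvent

/-! ### Choice of the parameters -/

/-- With `n = X ^ 3`, `log n = Y ^ 3` and `2 t = n ^ α`, these are the consequences of the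
assumptions on `α` which the regret bound uses. -/
structure Params (N T : ℕ) (α X Y : ℝ) : Prop where
  six_le : 6 ≤ X
  one_le : 1 ≤ Y
  pow_X : X ^ 3 = N
  pow_Y : Y ^ 3 = Real.log N
  two_mul_le : 2 * Y ^ 2 ≤ X
  T_lower : X ^ 2 ≤ T
  T_upper : 2 * (T : ℝ) ≤ N
  numCells_eq : numCells α T = ⌊X / Y ^ 2⌋₊
  rpow_lower : X / 2 ≤ (T : ℝ) ^ (1 / (3 * α))

/-- The lower bound on α says that 2T exceeds 2 (N log N)^(2/3); combined with α ≤ 1 it also gives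
2Y² ≤ X. Since log(2T) = α log N, all powers of α cancel in the number of cells. -/
theorem exists_params {N T : ℕ} {α : ℝ} (hα : 2 / 3 + epsilon N < α) (hα1 : α ≤ 1)
    (hT : (T : ℝ) = 0.5 * (N : ℝ) ^ α) (hX : 6 ≤ (N : ℝ) ^ (1 / 3 : ℝ)) :
    ∃ X Y, Params N T α X Y := by
  set X := (N : ℝ) ^ (1 / 3 : ℝ) with hXdef
  have hX3 : X ^ 3 = N := by
    rw [hXdef, ← Real.rpow_natCast, ← Real.rpow_mul (Nat.cast_nonneg _)]
    norm_num
  have hX0 : 0 < X := by linarith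
  have hN216 : (216 : ℝ) ≤ N := by
    rw [← hX3]
    calc (216 : ℝ) = 6 ^ 3 := by norm_num
      _ ≤ X ^ 3 := by gcongr
  have hN0 : (0 : ℝ) < N := by linarith
  have hlog1 : 1 ≤ Real.log N := by
    rw [Real.le_log_iff_exp_le hN0]
    linarith [Real.exp_one_lt_d9]
  set Λ := Real.log N with hΛ
  have hΛ0 : 0 < Λ := by linarith
  set Y := Λ ^ (1 / 3 : ℝ) with hYdef
  have hY1 : 1 ≤ Y := Real.one_le_rpow hlog1 (by norm_num)
  have hY0 : 0 < Y := by linarith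
  have hY3 : Y ^ 3 = Λ := by
    rw [hYdef, ← Real.rpow_natCast, ← Real.rpow_mul hΛ0.le]
    norm_num
  have hlogX : Real.log X = Λ / 3 := by rw [hXdef, Real.log_rpow hN0]; ring
  have hlogY : Real.log Y = Real.log Λ / 3 := by rw [hYdef, Real.log_rpow hΛ0]; ring
  have hε0 : 0 ≤ epsilon N := by
    unfold epsilon
    have := Real.log_nonneg hlog1
    have := Real.log_nonneg one_le_two
    positivity
  have hεΛ : epsilon N * Λ = 2 / 3 * Real.log Λ + Real.log 2 := by
    rw [epsilon, div_mul_cancel₀ _ hΛ0.ne']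
  have hα0 : 0 < α := by linarith
  have hT2 : 2 * (T : ℝ) = (N : ℝ) ^ α := by rw [hT]; ring
  refine ⟨X, Y, hX, hY1, hX3, hY3, ?_, ?_, ?_, ?_, ?_⟩
  · rw [← Real.log_le_log_iff (by positivity) hX0, Real.log_mul (by norm_num) (by positivity),
      Real.log_pow, hlogX, hlogY]
    push_cast
    nlinarith
  · have : Real.log (2 * X ^ 2) ≤ Real.log (2 * T) := by
      rw [hT2, Real.log_rpow hN0, Real.log_mul (by norm_num) (by positivity), Real.log_pow, hlogX]
      push_cast
      have := Real.log_nonneg hlog1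
      have : (2 / 3 + epsilon N) * Λ ≤ α * Λ := by gcongr
      linarith
    rw [Real.log_le_log_iff (by positivity) (by rw [hT2]; positivity)] at this
    linarith
  · rw [hT2]
    calc (N : ℝ) ^ α ≤ (N : ℝ) ^ (1 : ℝ) := Real.rpow_le_rpow_of_exponent_le (by linarith) hα1
      _ = N := Real.rpow_one _
  · unfold numCells
    congr 1
    rw [hT2, Real.log_rpow hN0, ← Real.rpow_mul hN0.le, Real.mul_rpow hα0.le hΛ0.le]
    have e1 : α * (1 / (3 * α)) = 1 / 3 := by field_simp
    have e2 : α ^ (2 / 3 : ℝ) * α ^ (-(2 / 3) : ℝ) = 1 := by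
      rw [← Real.rpow_add hα0]; simp
    have e3 : Λ ^ (-(2 / 3) : ℝ) = (Y ^ 2)⁻¹ := by
      rw [hYdef, ← Real.rpow_natCast, ← Real.rpow_mul hΛ0.le, Real.rpow_neg hΛ0.le]
      norm_num
    rw [e1, e3]
    calc α ^ (2 / 3 : ℝ) * X * (α ^ (-(2 / 3) : ℝ) * (Y ^ 2)⁻¹)
        = α ^ (2 / 3 : ℝ) * α ^ (-(2 / 3) : ℝ) * (X * (Y ^ 2)⁻¹) := by ring
      _ = _ := by rw [e2, one_mul, div_eq_mul_inv]
  · have e1 : α * (1 / (3 * α)) = 1 / 3 := by field_simp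
    have h1 : (1 : ℝ) / (3 * α) ≤ 1 := by
      rw [div_le_one (by positivity)]; linarith
    -- The (3α)-th root of 2T is X, and removing the factor 2 costs at most 2 because 3α ≥ 1.
    have h2 : (2 : ℝ) ^ (1 / (3 * α)) ≤ 2 := by
      calc (2 : ℝ) ^ (1 / (3 * α)) ≤ 2 ^ (1 : ℝ) :=
            Real.rpow_le_rpow_of_exponent_le one_le_two h1
        _ = 2 := Real.rpow_one _
    have h3 : (2 : ℝ) ^ (1 / (3 * α)) * (T : ℝ) ^ (1 / (3 * α)) = X := by
      rw [← Real.mul_rpow zero_le_two (Nat.cast_nonneg _), hT2, ← Real.rpow_mul hN0.le, e1]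
    have h4 : (0 : ℝ) ≤ (T : ℝ) ^ (1 / (3 * α)) := by positivity
    rw [← h3]
    nlinarith

/-! ### Numerical consequences of the choice of parameters. -/

namespace Params

variable {N T : ℕ} {α X Y : ℝ} (P : Params N T α X Y)
include P

theorem numCells_bounds : 0 < numCells α T ∧ (numCells α T : ℝ) ≤ X / Y ^ 2 ∧
    X / Y ^ 2 ≤ 2 * numCells α T := by
  have hX := P.six_le
  have hY := P.one_le
  have h2 : 2 ≤ X / Y ^ 2 := by
    rw [le_div_iff₀ (by positivity)]
    exact P.two_mul_le
  rw [P.numCells_eq]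
  refine ⟨Nat.floor_pos.2 (by linarith), Nat.floor_le (by linarith), ?_⟩
  have := Nat.lt_floor_add_one (X / Y ^ 2)
  have h1 : (1 : ℝ) ≤ ⌊X / Y ^ 2⌋₊ := by
    exact_mod_cast Nat.floor_pos.2 (by linarith : 1 ≤ X / Y ^ 2)
  linarith

theorem numCells_le : (numCells α T : ℝ) ≤ X := by
  refine P.numCells_bounds.2.1.trans (div_le_self ?_ ?_)
  · linarith [P.six_le]
  · exact one_le_pow₀ P.one_le

theorem N_pos : (0 : ℝ) < N := by
  rw [← P.pow_X]
  have := P.six_le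
  positivity

theorem T_pos : (0 : ℝ) < T := by
  refine lt_of_lt_of_le ?_ P.T_lower
  have := P.six_le
  positivity

theorem log_X : Real.log X = Y ^ 3 / 3 := by
  rw [P.pow_Y, ← P.pow_X, Real.log_pow]
  push_cast
  ring

theorem log_T_mem : Real.log T ∈ Set.Icc (2 / 3 * Y ^ 3) (Y ^ 3) := by
  have hX := P.six_le
  constructor
  · have := Real.log_le_log (by positivity) P.T_lower
    rw [Real.log_pow, P.log_X] at this
    push_cast at this
    linarith
  · rw [P.pow_Y]
    exact Real.log_le_log P.T_pos (by linarith [P.T_upper, P.T_pos])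

theorem log_div : Real.log (T / (N : ℝ) ^ (-(4 / 3) : ℝ)) = Real.log T + 4 / 3 * Y ^ 3 := by
  rw [Real.log_div P.T_pos.ne' (Real.rpow_pos_of_pos P.N_pos _).ne', Real.log_rpow P.N_pos, P.pow_Y]
  ring

theorem rpow_eq : (N : ℝ) ^ (-(4 / 3) : ℝ) = (X ^ 4)⁻¹ := by
  have hX := P.six_le
  rw [← P.pow_X, ← Real.rpow_natCast, ← Real.rpow_mul (by linarith), ← Real.rpow_natCast,
    ← Real.rpow_neg (by linarith)]
  norm_num

/-- Since K ≤ N^(1/3), the first term is at most 2/N. For the second, K ≤ X/Y² and X ≥ 6 make the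
exponent at least 3 log N. -/
theorem failure_le : 2 * (numCells α T : ℝ) * (N : ℝ) ^ (-(4 / 3) : ℝ) +
    (4 * numCells α T + 2) * Real.exp (-(N / (2 * (numCells α T : ℝ) ^ 2))) ≤ 12 * (N : ℝ)⁻¹ := by
  have hX := P.six_le
  have hY := P.one_le
  have hK := P.numCells_le
  have hK0 : (0 : ℝ) < numCells α T := by exact_mod_cast P.numCells_bounds.1
  have hN := P.N_pos
  have h1 : 2 * (numCells α T : ℝ) * (N : ℝ) ^ (-(4 / 3) : ℝ) ≤ 2 * (N : ℝ)⁻¹ := by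
    rw [P.rpow_eq, ← P.pow_X]
    calc 2 * (numCells α T : ℝ) * (X ^ 4)⁻¹ ≤ 2 * X * (X ^ 4)⁻¹ := by gcongr
      _ = 2 * (X ^ 3)⁻¹ := by field_simp
  have h2 : 3 * Y ^ 3 ≤ N / (2 * (numCells α T : ℝ) ^ 2) := by
    rw [le_div_iff₀ (by positivity), ← P.pow_X]
    have h3 : (numCells α T : ℝ) ^ 2 ≤ (X / Y ^ 2) ^ 2 := by
      gcongr
      exact P.numCells_bounds.2.1
    calc 3 * Y ^ 3 * (2 * (numCells α T : ℝ) ^ 2) ≤ 3 * Y ^ 3 * (2 * (X / Y ^ 2) ^ 2) := by gcongr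
      _ = 6 * X ^ 2 / Y := by field_simp; ring
      _ ≤ 6 * X ^ 2 := div_le_self (by positivity) hY
      _ ≤ X * X ^ 2 := by gcongr
      _ = X ^ 3 := by ring
  have h3 : Real.exp (-(N / (2 * (numCells α T : ℝ) ^ 2))) ≤ ((N : ℝ) ^ 3)⁻¹ := by
    calc Real.exp (-(N / (2 * (numCells α T : ℝ) ^ 2))) ≤ Real.exp (-(3 * Real.log N)) := by
          rw [Real.exp_le_exp, ← P.pow_Y]
          linarith
      _ = ((N : ℝ) ^ 3)⁻¹ := by
          rw [Real.exp_neg, ← Real.exp_log (pow_pos hN 3), Real.log_pow]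
          norm_num
  have hXN : X ≤ N := by
    rw [← P.pow_X]
    exact le_self_pow₀ (by linarith) (by norm_num)
  have h4 : (4 * (numCells α T : ℝ) + 2) * Real.exp (-(N / (2 * (numCells α T : ℝ) ^ 2))) ≤
      10 * (N : ℝ)⁻¹ := by
    calc _ ≤ (10 * (N : ℝ) ^ 2) * ((N : ℝ) ^ 3)⁻¹ := by
          gcongr
          nlinarith
      _ = _ := by field_simp
  linarith

theorem setting {m : I → ℝ} {L Q : ℝ} (hm : Measurable m) (hm01 : ∀ x, m x ∈ Set.Icc (0 : ℝ) 1)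
    (hL : 0 < L) (hQ : 0 < Q) (hlip : WeakLipschitz m (threshold m ((T : ℝ) / N)) L)
    (hmar : Margin m (threshold m ((T : ℝ) / N)) Q) :
    Setting m (threshold m ((T : ℝ) / N)) L Q ((T : ℝ) / N) N (numCells α T) T
      ((N : ℝ) ^ (-(4 / 3) : ℝ)) := by
  have hX := P.six_le
  have hY := P.one_le
  have hN := P.N_pos
  have hT := P.T_pos
  have hp0 : 0 < (T : ℝ) / N := by positivity
  have hp1 : (T : ℝ) / N < 1 := by
    rw [div_lt_one hN]
    linarith [P.T_upper]
  obtain ⟨hK0, hK1, -⟩ := P.numCells_bounds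
  have hKX := P.numCells_le
  have hlogT := P.log_T_mem
  refine ⟨hm, hm01, threshold_mem hm01 hp0 hp1.le, hL, hlip, hmar,
    volume_threshold_eq hm01 hp0 hp1.le hQ hmar, hp0, hp1, ?_, hK0, ?_, ?_, ?_, ?_⟩
  · field_simp
  · rw [← P.pow_X]
    nlinarith [mul_le_mul hX hX (by norm_num) (by linarith)]
  · rw [← P.pow_X]
    calc (numCells α T : ℝ) ^ 2 ≤ X ^ 2 := by gcongr
      _ ≤ X ^ 3 := pow_le_pow_right₀ (by linarith) (by norm_num)
  · rw [P.log_div]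
    have := hlogT.1
    have : 0 ≤ Y ^ 3 := by positivity
    linarith
  · rw [P.log_div, ← P.pow_X]
    calc (Real.log T + 4 / 3 * Y ^ 3) * (numCells α T : ℝ) ^ 3
        ≤ (3 * Y ^ 3) * (X / Y ^ 2) ^ 3 := by
          have : 0 ≤ Y ^ 3 := by positivity
          gcongr
          linarith [hlogT.2]
      _ = 3 * X ^ 3 / Y ^ 3 := by field_simp
      _ ≤ 3 * X ^ 3 := div_le_self (by positivity) (one_le_pow₀ hY)

/-- With K comparable to X/Y², each term is O(X Y⁴), that is, O(N^(1/3) (log N)^(4/3)). The factor 5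
pays for passing from N to T: (1/2) · (2/3)^(4/3) ≥ 2/9 ≥ 1/5. -/
theorem regret_bound_le {q c : ℝ} (hq : 1 ≤ q) :
    6 * q * c ^ 2 * (N / (numCells α T : ℝ) ^ 2) + 2 * numCells α T +
      64 * q * Real.log (T / (N : ℝ) ^ (-(4 / 3) : ℝ)) * numCells α T *
        (Nat.log 2 (numCells α T) + 1) ≤
    5 * (24 * q * c ^ 2 + 2 + 384 * q) * (T : ℝ) ^ (1 / (3 * α)) * Real.log T ^ (4 / 3 : ℝ) := by
  have hX := P.six_le
  have hY := P.one_le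
  have hN := P.N_pos
  obtain ⟨hK0, hK1, hK2⟩ := P.numCells_bounds
  have hK0' : (0 : ℝ) < numCells α T := by exact_mod_cast hK0
  have hlogT := P.log_T_mem
  set K := numCells α T
  have hY3 : 1 ≤ Y ^ 3 := one_le_pow₀ hY
  have h1 : N / (K : ℝ) ^ 2 ≤ 4 * (X * Y ^ 4) := by
    rw [div_le_iff₀ (by positivity), ← P.pow_X]
    calc X ^ 3 = X * Y ^ 4 * (X / Y ^ 2) ^ 2 := by field_simp
      _ ≤ X * Y ^ 4 * (2 * K) ^ 2 := by gcongr
      _ = _ := by ring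
  have h2 : (K : ℝ) ≤ X * Y ^ 4 :=
    P.numCells_le.trans (le_mul_of_one_le_right (by linarith) (one_le_pow₀ hY))
  have hlogK : (Nat.log 2 K : ℝ) + 1 ≤ 2 * Y ^ 3 := by
    have h3 : ((2 : ℝ) ^ Nat.log 2 K) ≤ X := by
      refine le_trans ?_ P.numCells_le
      exact_mod_cast Nat.pow_log_le_self 2 hK0.ne'
    have h4 := Real.log_le_log (by positivity) h3
    rw [Real.log_pow, P.log_X] at h4
    have h5 : (Nat.log 2 K : ℝ) * (1 / 2) ≤ Nat.log 2 K * Real.log 2 := by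
      gcongr
      linarith [Real.log_two_gt_d9]
    linarith
  have h3 : Real.log (T / (N : ℝ) ^ (-(4 / 3) : ℝ)) * K * (Nat.log 2 K + 1) ≤ 6 * (X * Y ^ 4) := by
    rw [P.log_div]
    have h0 : 0 ≤ Real.log T + 4 / 3 * Y ^ 3 := by linarith [hlogT.1]
    calc (Real.log T + 4 / 3 * Y ^ 3) * K * (Nat.log 2 K + 1)
        ≤ (3 * Y ^ 3) * (X / Y ^ 2) * (2 * Y ^ 3) := by
          gcongr
          linarith [hlogT.2]
      _ = _ := by field_simp; ring
  have h4 : X * Y ^ 4 / 5 ≤ (T : ℝ) ^ (1 / (3 * α)) * Real.log T ^ (4 / 3 : ℝ) := by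
    have h5 : 4 / 9 * Y ^ 4 ≤ Real.log T ^ (4 / 3 : ℝ) := by
      calc 4 / 9 * Y ^ 4 = (2 / 3 : ℝ) ^ (2 : ℝ) * Y ^ 4 := by norm_num
        _ ≤ (2 / 3 : ℝ) ^ (4 / 3 : ℝ) * Y ^ 4 := by
            gcongr ?_ * _
            exact Real.rpow_le_rpow_of_exponent_ge (by norm_num) (by norm_num) (by norm_num)
        _ = (2 / 3 * Y ^ 3) ^ (4 / 3 : ℝ) := by
            rw [Real.mul_rpow (by norm_num) (by positivity), ← Real.rpow_natCast Y 3,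
              ← Real.rpow_mul (by positivity), ← Real.rpow_natCast Y 4]
            norm_num
        _ ≤ _ := Real.rpow_le_rpow (by positivity) hlogT.1 (by norm_num)
    calc X * Y ^ 4 / 5 ≤ (X / 2) * (4 / 9 * Y ^ 4) := by
          have : 0 ≤ X * Y ^ 4 := by positivity
          linarith
      _ ≤ _ := by
          gcongr
          exact P.rpow_lower
  have h5 : 0 ≤ 24 * q * c ^ 2 + 2 + 384 * q := by positivity
  calc _ = 6 * q * c ^ 2 * (N / (K : ℝ) ^ 2) + 2 * K +
        64 * q * (Real.log (T / (N : ℝ) ^ (-(4 / 3) : ℝ)) * K * (Nat.log 2 K + 1)) := by ring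
    _ ≤ 6 * q * c ^ 2 * (4 * (X * Y ^ 4)) + 2 * (X * Y ^ 4) + 64 * q * (6 * (X * Y ^ 4)) := by
        gcongr
    _ = 5 * (24 * q * c ^ 2 + 2 + 384 * q) * (X * Y ^ 4 / 5) := by ring
    _ ≤ _ := by
        rw [mul_assoc _ ((T : ℝ) ^ _)]
        gcongr

end Params

end FCAB

end

/-! ### The high-probability regret bound. -/

theorem corollary1 :
    ∀ L Q : ℝ, 0 < L → 0 < Q → ∃ C : ℝ, 0 < C ∧
      ∀ (N T : ℕ) (α : ℝ), 2 ≤ N →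
        2 / 3 + FCAB.epsilon N < α → α ≤ 1 → (T : ℝ) = 0.5 * (N : ℝ) ^ α →
      ∀ m : unitInterval → ℝ, Measurable m → (∀ x, m x ∈ Set.Icc (0 : ℝ) 1) →
        FCAB.WeakLipschitz m (FCAB.threshold m ((T : ℝ) / N)) L →
        FCAB.Margin m (FCAB.threshold m ((T : ℝ) / N)) Q →
      ∀ {Ω : Type*} [MeasurableSpace Ω] (μ : MeasureTheory.Measure Ω)
        [MeasureTheory.IsProbabilityMeasure μ]
        (a : Fin N → Ω → unitInterval) (y : Fin N → Ω → ℝ) (φ : ℕ → Ω → Fin N),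
        FCAB.IsEnvironment μ m a y →
        FCAB.IsUCBF μ a y T (FCAB.numCells α T) ((N : ℝ) ^ (-(4 / 3) : ℝ)) φ →
        1 - 12 * max ((N : ℝ)⁻¹) (Real.exp (-(N : ℝ) ^ (1 / 3 : ℝ) / 3)) ≤
          μ.real {ω | FCAB.regret m T (fun i => a i ω) (fun t => φ t ω) ≤
            C * (T : ℝ) ^ (1 / (3 * α)) * Real.log T ^ (4 / 3 : ℝ)} := by
  intro L Q hL hQ
  have hq : 1 ≤ max Q 1 := le_max_right _ _
  refine ⟨5 * (24 * max Q 1 * FCAB.Setting.nearConst L Q ^ 2 + 2 + 384 * max Q 1), by positivity, ?_⟩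
  intro N T α _ hα hα1 hT m hm hm01 hlip hmar Ω _ μ _ a y φ hE hA
  rcases lt_or_ge ((N : ℝ) ^ (1 / 3 : ℝ)) 6 with hX | hX
  -- For N^(1/3) < 6 the claimed probability is not positive, since 12 exp(-2) ≥ 1; this is where
  -- the second term of the maximum serves.
  · have h1 : 1 ≤ 12 * Real.exp (-(N : ℝ) ^ (1 / 3 : ℝ) / 3) := by
      have h2 : Real.exp (-2) ≤ Real.exp (-(N : ℝ) ^ (1 / 3 : ℝ) / 3) := by
        rw [Real.exp_le_exp]
        linarith
      have h3 : Real.exp 2 ≤ 12 := by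
        have : Real.exp 2 = Real.exp 1 ^ 2 := by rw [← Real.exp_nat_mul]; norm_num
        rw [this]
        nlinarith [Real.exp_one_lt_d9, Real.exp_pos 1]
      have h4 : Real.exp (-2) * Real.exp 2 = 1 := by rw [← Real.exp_add]; norm_num
      nlinarith [Real.exp_pos (-2)]
    have h5 := le_max_right ((N : ℝ)⁻¹) (Real.exp (-(N : ℝ) ^ (1 / 3 : ℝ) / 3))
    refine le_trans ?_ MeasureTheory.measureReal_nonneg
    linarith
  · obtain ⟨X, Y, P⟩ := FCAB.exists_params hα hα1 hT hX
    have s := P.setting hm hm01 hL hQ hlip hmar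
    have hgood := FCAB.le_measure_isGoodRun hE hm hm01 hA (FCAB.threshold m ((T : ℝ) / N)) L
      (by exact_mod_cast P.T_pos) (Real.rpow_pos_of_pos P.N_pos _) s.log_nonneg
    have hmax := le_max_left ((N : ℝ)⁻¹) (Real.exp (-(N : ℝ) ^ (1 / 3 : ℝ) / 3))
    calc _ ≤ _ := by linarith [P.failure_le]
      _ ≤ _ := hgood
      _ ≤ _ := MeasureTheory.measureReal_mono fun ω ⟨sel, h⟩ =>
        (s.regret_le_of_isGoodRun h).trans (P.regret_bound_le hq)
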